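/- Theorem (bounds on subordination functions). Notation. $\mathbb C^+=\{z\in\mathbb C:\operatorname{Im} z>0\}$. For a Borel probability measure $\mu$ on $\mathbb R$ let $m_\mu(z)=\int_{\mathbb R}\frac{d\mu(x)}{x-z}$ and $F_\mu(z)=-1/m_\mu(z)$, $z\in\mathbb C^+$, and let $\mu^{\mathrm{sym}}(A)=\frac12[\mu(A)+\mu(-A)]$. The subordination functions of two probability measures $\mu_1,\mu_2$ are the unique analytic functions $\omega_1,\omega_2:\mathbb C^+\to\mathbb C^+$ with $\operatorname{Im}\omega_j(z)\ge\operatorname{Im} z$, $\lim_{\eta\to\infty}\omega_j(i\eta)/(i\eta)=1$ for $j=1,2$, and $F_{\mu_1}(\omega_2(z))=F_{\mu_2}(\omega_1(z))=\omega_1(z)+\omega_2(z)-z$ on $\mathbb C^+$; the free additive convolution $\mu_1\boxplus\mu_2$ is the probability measure with $F_{\mu_1\boxplus\mu_2}(z)=F_{\mu_1}(\omega_2(z))$ on $\mathbb C^+$. Let $\mu_\sigma$ be a Borel probability measure on $\mathbb R$ with compact support contained in $[0,\infty)$, and put $$r_-=\Big(\int_{[0,\infty)} x^{-2}\,d\mu_\sigma(x)\Big)^{-1/2},\qquad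 r_+=\Big(\int_{[0,\infty)} x^{2}\,d\mu_\sigma(x)\Big)^{1/2},$$ with $r_-=0$ if the first integral diverges (in particular if $\mu_\sigma(\{0\})>0$). Then the support of $\mu_\sigma$ contains more than one point if and only if $r_-<r_+$. Assume that this is the case. Let $\tau>0$ and $\eta_M<\infty$, and set $J=[r_-+\tau,\,r_+-\tau]$. For $r\in J$ let $\mu_1=\mu_\sigma^{\mathrm{sym}}$, $\mu_2=\delta_r^{\mathrm{sym}}$, and let $\omega_1,\omega_2$ be their subordination functions and $\mu_{\sigma,r}=\mu_1\boxplus\mu_2$; these exist. Then $\omega_1$, $\omega_2$ and $m_{\mu_1\boxplus\mu_2}$ have finite limits at $0$ from $\mathbb C^+$, which we use as their values at $0$, and there are constants $c>0$ and $C<\infty$, depending only on $\mu_1$, $\tau$ and $\eta_M$, such that for all $r\in J$ and all $\eta\in[0,\eta_M]$ $$|\omega_1(i\eta)|\le C,\quad |\omega_2(i\eta)|\le C,\quad \operatorname{Im}\omega_1(i\eta)\ge c,\quad \operatorname{Im}\omega_2(i\eta)\ge c,\quad c\le|m_{\mu_1\boxplus\mu_2}(i\eta)|\le C.$$ In particular,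 for every $r\in J$ the measure $\mu_{\sigma,r}$ is absolutely continuous with a continuous density in a neighbourhood of $0$, and this density satisfies $c\le\pi\mu_{\sigma,r}(0)\le C$. -/

import Mathlib

open MeasureTheory Filter Topology Set

/-- The open upper half-plane as a subset of the complex numbers. -/
def upperHalf : Set ℂ := {z : ℂ | 0 < z.im}

/-- The Stieltjes transform `m_μ(z) = ∫ dμ(x) / (x - z)`. -/
noncomputable def stieltjes (μ : Measure ℝ) (z : ℂ) : ℂ :=
  ∫ x : ℝ, ((x : ℂ) - z)⁻¹ ∂μ

/-- The negative reciprocal Stieltjes transform `F_μ(z) = -1 / m_μ(z)`. -/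
noncomputable def negRecipStieltjes (μ : Measure ℝ) (z : ℂ) : ℂ :=
  -(stieltjes μ z)⁻¹

/-- `ω = (ω₁, ω₂)` is a pair of subordination functions for `μ₁` and `μ₂`. Only the values of
`ω₁` and `ω₂` on the upper half-plane are constrained. -/
structure IsSubordinationPair (μ₁ μ₂ : Measure ℝ) (ω : (ℂ → ℂ) × (ℂ → ℂ)) : Prop where
  analytic_fst : DifferentiableOn ℂ ω.1 upperHalf
  analytic_snd : DifferentiableOn ℂ ω.2 upperHalf
  im_le_fst : ∀ z ∈ upperHalf, z.im ≤ (ω.1 z).im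
  im_le_snd : ∀ z ∈ upperHalf, z.im ≤ (ω.2 z).im
  tendsto_fst : Tendsto (fun η : ℝ => ω.1 (Complex.I * η) / (Complex.I * η)) atTop (𝓝 1)
  tendsto_snd : Tendsto (fun η : ℝ => ω.2 (Complex.I * η) / (Complex.I * η)) atTop (𝓝 1)
  eq_F : ∀ z ∈ upperHalf, negRecipStieltjes μ₁ (ω.2 z) = negRecipStieltjes μ₂ (ω.1 z)
  add_eq : ∀ z ∈ upperHalf, ω.1 z + ω.2 z - z = negRecipStieltjes μ₁ (ω.2 z)

/-- The pair of subordination functions `(ω₁, ω₂)` of `μ₁` and `μ₂` (unique on the upper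
half-plane for probability measures). -/
noncomputable def subordinationPair (μ₁ μ₂ : Measure ℝ) : (ℂ → ℂ) × (ℂ → ℂ) :=
  Classical.epsilon (IsSubordinationPair μ₁ μ₂)

/-- `μ` is a free additive convolution of `μ₁` and `μ₂`: it is the probability measure with
`F_μ(z) = F_{μ₁}(ω₂(z))` on the upper half-plane. -/
structure IsFreeAddConv (μ₁ μ₂ μ : Measure ℝ) : Prop where
  isProbabilityMeasure : IsProbabilityMeasure μ
  eq_F : ∀ z ∈ upperHalf, negRecipStieltjes μ z =
    negRecipStieltjes μ₁ ((subordinationPair μ₁ μ₂).2 z)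

/-- The free additive convolution `μ₁ ⊞ μ₂`. -/
noncomputable def freeAddConv (μ₁ μ₂ : Measure ℝ) : Measure ℝ :=
  Classical.epsilon (IsFreeAddConv μ₁ μ₂)

/-- The symmetrization `μ^sym(A) = (μ(A) + μ(-A)) / 2`. -/
noncomputable def symmetrization (μ : Measure ℝ) : Measure ℝ :=
  (2⁻¹ : ENNReal) • (μ + μ.map (fun x => -x))

/-- The inner radius `r₋ = (∫ x⁻² dμ(x))^(-1/2)` over `[0, ∞)`, equal to `0` if the integral
diverges; here `x⁻² = ∞` at `x = 0`. -/
noncomputable def innerRadius (μ : Measure ℝ) : ℝ :=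
  ((∫⁻ x in Ici (0 : ℝ), (ENNReal.ofReal (x ^ 2))⁻¹ ∂μ) ^ (-(1 / 2) : ℝ)).toReal

/-- The outer radius `r₊ = (∫ x² dμ(x))^(1/2)` over `[0, ∞)`. -/
noncomputable def outerRadius (μ : Measure ℝ) : ℝ :=
  Real.sqrt (∫ x in Ici (0 : ℝ), x ^ 2 ∂μ)

/-- The function `f` on the upper half-plane has a finite limit at the point `z`. -/
def HasBoundaryValue (f : ℂ → ℂ) (z : ℂ) : Prop :=
  ∃ w : ℂ, Tendsto f (𝓝[upperHalf] z) (𝓝 w)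

/-- The value at `z` of the extension by continuity of a function on the upper half-plane. -/
noncomputable def extendToBoundary (f : ℂ → ℂ) (z : ℂ) : ℂ :=
  extendFrom upperHalf f z

/-- Near the point `x`, the measure `μ` is absolutely continuous with a continuous density, and
the value of this density at `x` is `d`. -/
def HasDensityAt (μ : Measure ℝ) (x d : ℝ) : Prop :=
  ∃ (U : Set ℝ) (f : ℝ → ℝ), IsOpen U ∧ x ∈ U ∧ ContinuousOn f U ∧ (∀ y ∈ U, 0 ≤ f y) ∧
    μ.restrict U = (volume.restrict U).withDensity (fun y => ENNReal.ofReal (f y)) ∧ f x = d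

/-! Write `h(w) = F_{μ₁}(w) - w` and `A = ∫ x² dμσ`. Because `F_{μ₂}(w) = w - r²/w`, the
subordination system collapses to `ω₂ = z - r²/ω₁` and `ω₁ = z + h(z - r²/ω₁)`, a fixed-point
equation for `ω₁` alone. Cauchy–Schwarz for covariances of resolvents shows that `h` has nonnegative
imaginary part, satisfies a Schwarz–Pick inequality and obeys `|h(w)| ≤ A / Im w`. Hence the
fixed-point map strictly contracts `|a - b|² / (Im a · Im b)` (`subordinationMap_contraction`). This
gives existence, uniqueness and analyticity of `ω₁`, hence of `ω₂`. The function `m_{μ₁}(ω₂(z))` is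
then the Stieltjes transform of a probability measure by the Herglotz representation
(`exists_probabilityMeasure_stieltjes_eq`), and that measure is the free convolution.

Symmetry makes everything purely imaginary on the imaginary axis: `ω₁(iη) = i y₁`, `ω₂(iη) = i y`
with `y = η + r²/y₁` and `y (y₁ - η) = G(y)`, where `G(y) = y · Im h(iy) = 1 / ∫ (x² + y²)⁻¹ dμσ -
y²`. For `R > r₋` the value `G(y)` is below `R²` for small `y`; for `R < r₊` it is above `R²` for
large `y`. At `η = 0` the equations read `y y₁ = r² = G(y)`, so for `r₋ < r < r₊` the intermediate
value theorem supplies a solution. Its linearisation is nonzero by strict Cauchy–Schwarz, as `μσ` is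
not a point mass (`exists_hasDerivAt_subordinationPart`). The implicit function theorem continues it
to a neighbourhood of `0`, and uniqueness of fixed points identifies the continuation with `ω₁` on
the upper half-plane (`IsPickMap.exists_continuousOn_fixedPoint`). Boundary limits follow, and
Stieltjes inversion gives the continuous density.

For uniformity, `G` is compared with `r²` at thresholds chosen once for all `r` in `J`; elementary
inequalities then confine `y` and `y₁` to a compact subset of `(0, ∞)` (`subordination_bounds`), and
`m(iη) = i / (y + y₁ - η)`. -/

lemma isOpen_upperHalf : IsOpen upperHalf := isOpen_lt continuous_const Complex.continuous_im

/-! ### Cauchy–Schwarz for covariances -/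

section Covariance

variable {α : Type*} [MeasurableSpace α] {μ : Measure α}

lemma integral_mul_sq_le {u v : α → ℝ} (hu : MemLp u 2 μ) (hv : MemLp v 2 μ) :
    (∫ x, u x * v x ∂μ) ^ 2 ≤ (∫ x, u x ^ 2 ∂μ) * ∫ x, v x ^ 2 ∂μ := by
  -- This quadratic in `t` is `∫ (u + t v)²`; Cauchy–Schwarz is the sign of its discriminant.
  have h : ∀ t : ℝ, 0 ≤ (∫ x, v x ^ 2 ∂μ) * (t * t) + (2 * ∫ x, u x * v x ∂μ) * t
      + ∫ x, u x ^ 2 ∂μ := by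
    intro t
    have h0 : 0 ≤ ∫ x, (u x + t * v x) ^ 2 ∂μ := integral_nonneg fun x => sq_nonneg _
    have h1 : ∫ x, (u x + t * v x) ^ 2 ∂μ
        = ∫ x, (u x ^ 2 + (2 * t) * (u x * v x) + (t * t) * v x ^ 2) ∂μ := by
      congr 1; ext x; ring
    have huv : Integrable (fun x => u x * v x) μ := hu.integrable_mul hv
    rw [h1, integral_add (f := fun x => u x ^ 2 + (2 * t) * (u x * v x))
      (hu.integrable_sq.add (huv.const_mul _)) (hv.integrable_sq.const_mul _),
      integral_add hu.integrable_sq (huv.const_mul _),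
      integral_const_mul, integral_const_mul] at h0
    linarith
  have := discrim_le_zero h
  rw [discrim] at this
  nlinarith

lemma norm_integral_mul_sq_le {f g : α → ℂ} (hf : MemLp f 2 μ) (hg : MemLp g 2 μ) :
    ‖∫ x, f x * g x ∂μ‖ ^ 2 ≤ (∫ x, ‖f x‖ ^ 2 ∂μ) * ∫ x, ‖g x‖ ^ 2 ∂μ := by
  refine le_trans ?_ (integral_mul_sq_le hf.norm hg.norm)
  gcongr
  refine (norm_integral_le_integral_norm _).trans_eq ?_
  simp

lemma integral_sub_mean_mul [IsProbabilityMeasure μ] {f g : α → ℂ} (hf : MemLp f 2 μ)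
    (hg : MemLp g 2 μ) :
    ∫ x, (f x - ∫ y, f y ∂μ) * (g x - ∫ y, g y ∂μ) ∂μ
      = ∫ x, f x * g x ∂μ - (∫ x, f x ∂μ) * ∫ x, g x ∂μ := by
  have hf1 := hf.integrable (by norm_num)
  have hg1 := hg.integrable (by norm_num)
  set a := ∫ y, f y ∂μ with ha
  set b := ∫ y, g y ∂μ with hb
  have : ∀ x, (f x - a) * (g x - b) = f x * g x - b * f x - a * g x + a * b := fun x => by ring
  simp_rw [this]
  have hfg : Integrable (fun x => f x * g x) μ := hf.integrable_mul hg
  rw [integral_add (f := fun x => f x * g x - b * f x - a * g x)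
    ((hfg.sub (hf1.const_mul _)).sub (hg1.const_mul _)) (integrable_const _),
    integral_sub (f := fun x => f x * g x - b * f x) (hfg.sub (hf1.const_mul _))
    (hg1.const_mul _), integral_sub hfg (hf1.const_mul _),
    integral_const_mul, integral_const_mul]
  simp [← ha, ← hb]
  ring

lemma integral_norm_sub_mean_sq [IsProbabilityMeasure μ] {f : α → ℂ} (hf : MemLp f 2 μ) :
    ∫ x, ‖f x - ∫ y, f y ∂μ‖ ^ 2 ∂μ = ∫ x, ‖f x‖ ^ 2 ∂μ - ‖∫ x, f x ∂μ‖ ^ 2 := by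
  have h := integral_sub_mean_mul hf hf.star
  have hs : ∫ y, (star f) y ∂μ = star (∫ y, f y ∂μ) := by
    simpa using (integral_conj (f := f) (μ := μ))
  rw [hs] at h
  have e : ∀ z : ℂ, z * star z = ((‖z‖ ^ 2 : ℝ) : ℂ) := fun z => by
    simpa using Complex.mul_conj' z
  have h1 : ∀ x, (f x - ∫ y, f y ∂μ) * ((star f) x - star (∫ y, f y ∂μ))
      = ((‖f x - ∫ y, f y ∂μ‖ ^ 2 : ℝ) : ℂ) := fun x => by
    rw [← e, star_sub]; rfl
  have h2 : ∀ x, f x * (star f) x = ((‖f x‖ ^ 2 : ℝ) : ℂ) := fun x => by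
    rw [← e]; rfl
  simp_rw [h1, h2] at h
  rw [e, integral_complex_ofReal, integral_complex_ofReal] at h
  exact_mod_cast h

/-- Cauchy–Schwarz for the centred functions. The product `f g` carries no conjugation, so with two
resolvents the left side is a difference quotient of analytic functions. Both the Schwarz–Pick
inequality and the decay of `F_μ(w) - w` come from here. -/
lemma norm_covariance_sq_le [IsProbabilityMeasure μ] {f g : α → ℂ} (hf : MemLp f 2 μ)
    (hg : MemLp g 2 μ) :
    ‖∫ x, f x * g x ∂μ - (∫ x, f x ∂μ) * ∫ x, g x ∂μ‖ ^ 2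
      ≤ (∫ x, ‖f x‖ ^ 2 ∂μ - ‖∫ x, f x ∂μ‖ ^ 2) * (∫ x, ‖g x‖ ^ 2 ∂μ - ‖∫ x, g x ∂μ‖ ^ 2) := by
  rw [← integral_sub_mean_mul hf hg, ← integral_norm_sub_mean_sq hf,
    ← integral_norm_sub_mean_sq hg]
  exact norm_integral_mul_sq_le (hf.sub (memLp_const _)) (hg.sub (memLp_const _))

end Covariance

/-! ### Resolvents and the Stieltjes transform -/

section Stieltjes

lemma ofReal_sub_ne_zero {w : ℂ} (hw : w ∈ upperHalf) (x : ℝ) : (x : ℂ) - w ≠ 0 := by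
  intro h
  have := congrArg Complex.im h
  simp at this
  exact absurd hw (by simp [upperHalf, this])

lemma im_le_norm_ofReal_sub {w : ℂ} (x : ℝ) : w.im ≤ ‖(x : ℂ) - w‖ := by
  have := Complex.abs_im_le_norm ((x : ℂ) - w)
  simp at this
  exact (le_abs_self _).trans this

lemma norm_resolvent_le {w : ℂ} (hw : w ∈ upperHalf) (x : ℝ) :
    ‖((x : ℂ) - w)⁻¹‖ ≤ w.im⁻¹ := by
  rw [norm_inv]
  exact inv_anti₀ hw (im_le_norm_ofReal_sub x)

lemma continuous_resolvent {w : ℂ} (hw : w ∈ upperHalf) :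
    Continuous fun x : ℝ => ((x : ℂ) - w)⁻¹ :=
  (by fun_prop : Continuous fun x : ℝ => (x : ℂ) - w).inv₀ (ofReal_sub_ne_zero hw)

lemma im_resolvent (w : ℂ) (x : ℝ) :
    (((x : ℂ) - w)⁻¹).im = w.im * ‖((x : ℂ) - w)⁻¹‖ ^ 2 := by
  rw [Complex.inv_im, norm_inv, inv_pow, Complex.normSq_eq_norm_sq]
  simp [div_eq_mul_inv]

lemma resolvent_sub_resolvent {a b : ℂ} (ha : a ∈ upperHalf) (hb : b ∈ upperHalf) (x : ℝ) :
    ((x : ℂ) - a)⁻¹ - ((x : ℂ) - b)⁻¹ = (a - b) * (((x : ℂ) - a)⁻¹ * ((x : ℂ) - b)⁻¹) := by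
  have := ofReal_sub_ne_zero ha x
  have := ofReal_sub_ne_zero hb x
  field_simp
  ring

variable {μ : Measure ℝ} [IsFiniteMeasure μ]

lemma memLp_resolvent {w : ℂ} (hw : w ∈ upperHalf) (p : ENNReal) :
    MemLp (fun x : ℝ => ((x : ℂ) - w)⁻¹) p μ :=
  MemLp.of_bound (continuous_resolvent hw).aestronglyMeasurable _
    (Eventually.of_forall (norm_resolvent_le hw))

lemma integrable_resolvent {w : ℂ} (hw : w ∈ upperHalf) :
    Integrable (fun x : ℝ => ((x : ℂ) - w)⁻¹) μ :=
  (memLp_resolvent hw 1).integrable le_rfl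

lemma im_stieltjes {w : ℂ} (hw : w ∈ upperHalf) :
    (stieltjes μ w).im = w.im * ∫ x : ℝ, ‖((x : ℂ) - w)⁻¹‖ ^ 2 ∂μ := by
  rw [stieltjes, ← integral_const_mul]
  simp_rw [← im_resolvent w]
  exact (integral_im (integrable_resolvent hw)).symm

lemma stieltjes_sub_stieltjes {a b : ℂ} (ha : a ∈ upperHalf) (hb : b ∈ upperHalf) :
    stieltjes μ a - stieltjes μ b
      = (a - b) * ∫ x : ℝ, ((x : ℂ) - a)⁻¹ * ((x : ℂ) - b)⁻¹ ∂μ := by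
  rw [stieltjes, stieltjes, ← integral_sub (integrable_resolvent ha) (integrable_resolvent hb),
    ← integral_const_mul]
  simp_rw [resolvent_sub_resolvent ha hb]

lemma hasDerivAt_stieltjes {w : ℂ} (hw : w ∈ upperHalf) :
    HasDerivAt (stieltjes μ) (∫ x : ℝ, (((x : ℂ) - w)⁻¹) ^ 2 ∂μ) w := by
  have hw' : 0 < w.im := hw
  have hball : ∀ z ∈ Metric.ball w (w.im / 2), w.im / 2 ≤ z.im := by
    intro z hz
    have h1 := Complex.abs_im_le_norm (z - w)
    rw [Metric.mem_ball, dist_eq_norm] at hz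
    have := (abs_le.1 (h1.trans hz.le)).1
    simp at this
    linarith
  have hmem : ∀ z ∈ Metric.ball w (w.im / 2), z ∈ upperHalf := fun z hz =>
    lt_of_lt_of_le (by positivity) (hball z hz)
  refine (hasDerivAt_integral_of_dominated_loc_of_deriv_le (μ := μ)
    (F := fun z (x : ℝ) => ((x : ℂ) - z)⁻¹)
    (F' := fun z (x : ℝ) => (((x : ℂ) - z)⁻¹) ^ 2) (bound := fun _ => ((w.im / 2)⁻¹) ^ 2)
    (Metric.ball_mem_nhds w (half_pos hw')) ?_ (integrable_resolvent hw) ?_ ?_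
    (integrable_const _) ?_).2
  · filter_upwards [isOpen_upperHalf.mem_nhds hw] with z hz
    exact (continuous_resolvent hz).aestronglyMeasurable
  · exact ((continuous_resolvent hw).pow 2).aestronglyMeasurable
  · refine Eventually.of_forall fun x z hz => ?_
    rw [norm_pow]
    gcongr
    exact (norm_resolvent_le (hmem z hz) x).trans (inv_anti₀ (half_pos hw') (hball z hz))
  · refine Eventually.of_forall fun x z hz => ?_
    have h := ofReal_sub_ne_zero (hmem z hz) x
    have := ((hasDerivAt_id z).const_sub (x : ℂ)).inv h
    convert! this using 1
    simp

lemma differentiableOn_stieltjes : DifferentiableOn ℂ (stieltjes μ) upperHalf := fun _ hw =>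
  (hasDerivAt_stieltjes hw).differentiableAt.differentiableWithinAt

end Stieltjes

/-! ### The Nevanlinna function `F_μ(w) - w` -/

section Nevanlinna

variable {μ : Measure ℝ} [IsProbabilityMeasure μ]

lemma norm_stieltjes_le {w : ℂ} (hw : w ∈ upperHalf) : ‖stieltjes μ w‖ ≤ w.im⁻¹ := by
  have := norm_integral_le_of_norm_le_const (μ := μ)
    (Eventually.of_forall (norm_resolvent_le hw))
  simpa [stieltjes] using this

lemma im_stieltjes_pos {w : ℂ} (hw : w ∈ upperHalf) : 0 < (stieltjes μ w).im := by
  rw [im_stieltjes hw]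
  refine mul_pos hw ?_
  rw [integral_pos_iff_support_of_nonneg (fun x => by positivity)]
  · have : (Function.support fun x : ℝ => ‖((x : ℂ) - w)⁻¹‖ ^ 2) = univ := by
      ext x
      simp [ofReal_sub_ne_zero hw x]
    rw [this]
    simp
  · exact (memLp_resolvent hw 2).norm.integrable_sq

lemma stieltjes_ne_zero {w : ℂ} (hw : w ∈ upperHalf) : stieltjes μ w ≠ 0 := fun h => by
  have := im_stieltjes_pos (μ := μ) hw
  simp [h] at this

/-- The difference `F_μ(w) - w`, a Nevanlinna function. -/
noncomputable def subordinationPart (μ : Measure ℝ) (w : ℂ) : ℂ := negRecipStieltjes μ w - w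

/-- Since `Im (-1/m) = Im m / |m|²` and `Im m = Im w · ∫ |x - w|⁻²`, the imaginary part of `F_μ(w) -
w` is a positive multiple of the variance of the resolvent. This translates half-plane geometry into
variances. -/
lemma im_mul_variance_resolvent {w : ℂ} (hw : w ∈ upperHalf) :
    w.im * (∫ x : ℝ, ‖((x : ℂ) - w)⁻¹‖ ^ 2 ∂μ - ‖stieltjes μ w‖ ^ 2)
      = ‖stieltjes μ w‖ ^ 2 * (subordinationPart μ w).im := by
  have hm : ‖stieltjes μ w‖ ≠ 0 := norm_ne_zero_iff.2 (stieltjes_ne_zero hw)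
  rw [mul_sub, ← im_stieltjes hw]
  simp only [subordinationPart, negRecipStieltjes, Complex.sub_im, Complex.neg_im,
    Complex.inv_im, Complex.normSq_eq_norm_sq]
  field_simp

lemma variance_resolvent_nonneg {w : ℂ} (hw : w ∈ upperHalf) :
    0 ≤ ∫ x : ℝ, ‖((x : ℂ) - w)⁻¹‖ ^ 2 ∂μ - ‖stieltjes μ w‖ ^ 2 := by
  rw [stieltjes, ← integral_norm_sub_mean_sq (memLp_resolvent hw 2)]
  exact integral_nonneg fun x => by positivity

lemma subordinationPart_im_nonneg {w : ℂ} (hw : w ∈ upperHalf) :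
    0 ≤ (subordinationPart μ w).im := by
  have h := im_mul_variance_resolvent (μ := μ) hw
  have h1 := mul_nonneg (le_of_lt hw) (variance_resolvent_nonneg (μ := μ) hw)
  rw [h] at h1
  have hm : 0 < ‖stieltjes μ w‖ ^ 2 := by
    have := norm_pos_iff.2 (stieltjes_ne_zero (μ := μ) hw); positivity
  exact nonneg_of_mul_nonneg_right h1 hm

/-- Schwarz–Pick inequality for `F_μ(w) - w`. -/
lemma subordinationPart_schwarzPick {a b : ℂ} (ha : a ∈ upperHalf) (hb : b ∈ upperHalf) :
    ‖subordinationPart μ a - subordinationPart μ b‖ ^ 2 * (a.im * b.im)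
      ≤ ‖a - b‖ ^ 2 * ((subordinationPart μ a).im * (subordinationPart μ b).im) := by
  have hma := stieltjes_ne_zero (μ := μ) ha
  have hmb := stieltjes_ne_zero (μ := μ) hb
  have hna : 0 < ‖stieltjes μ a‖ := norm_pos_iff.2 hma
  have hnb : 0 < ‖stieltjes μ b‖ := norm_pos_iff.2 hmb
  set V := ∫ x : ℝ, ((x : ℂ) - a)⁻¹ * ((x : ℂ) - b)⁻¹ ∂μ - stieltjes μ a * stieltjes μ b with hV
  -- By the resolvent identity, the difference quotient of `F_μ(w) - w` is the covariance of the two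
  -- resolvents divided by `m(a) m(b)`.
  have key : (subordinationPart μ a - subordinationPart μ b) * (stieltjes μ a * stieltjes μ b)
      = (a - b) * V := by
    rw [hV, mul_sub, ← stieltjes_sub_stieltjes ha hb]
    simp only [subordinationPart, negRecipStieltjes]
    field_simp
    ring
  have hcov : ‖V‖ ^ 2 ≤ _ := norm_covariance_sq_le (memLp_resolvent (μ := μ) ha 2)
    (memLp_resolvent hb 2)
  have ea := im_mul_variance_resolvent (μ := μ) ha
  have eb := im_mul_variance_resolvent (μ := μ) hb
  have key2 := congrArg (fun z => ‖z‖ ^ 2) key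
  simp only [norm_mul, mul_pow] at key2
  refine le_of_mul_le_mul_right ?_ (by positivity : 0 < ‖stieltjes μ a‖ ^ 2 * ‖stieltjes μ b‖ ^ 2)
  calc _ = ‖a - b‖ ^ 2 * ‖V‖ ^ 2 * (a.im * b.im) := by rw [← key2]; ring
    _ ≤ ‖a - b‖ ^ 2 * ((∫ x : ℝ, ‖((x : ℂ) - a)⁻¹‖ ^ 2 ∂μ - ‖stieltjes μ a‖ ^ 2)
        * (∫ x : ℝ, ‖((x : ℂ) - b)⁻¹‖ ^ 2 ∂μ - ‖stieltjes μ b‖ ^ 2)) * (a.im * b.im) := by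
      have : 0 ≤ a.im * b.im := mul_nonneg (le_of_lt ha) (le_of_lt hb)
      gcongr
      exact hcov
    _ = ‖a - b‖ ^ 2 * ((a.im * (∫ x : ℝ, ‖((x : ℂ) - a)⁻¹‖ ^ 2 ∂μ - ‖stieltjes μ a‖ ^ 2))
        * (b.im * (∫ x : ℝ, ‖((x : ℂ) - b)⁻¹‖ ^ 2 ∂μ - ‖stieltjes μ b‖ ^ 2))) := by ring
    _ = _ := by rw [ea, eb]; ring

/-- For a centred measure, `|F_μ(w) - w|` is at most the variance over `Im w`. -/
lemma norm_subordinationPart_le (hx : MemLp (fun x : ℝ => x) 2 μ) (hmean : ∫ x, x ∂μ = 0) {w : ℂ}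
    (hw : w ∈ upperHalf) :
    ‖subordinationPart μ w‖ ≤ (∫ x, x ^ 2 ∂μ) / w.im := by
  have hw' : 0 < w.im := hw
  have hm := stieltjes_ne_zero (μ := μ) hw
  have hn : 0 < ‖stieltjes μ w‖ := norm_pos_iff.2 hm
  have hxc : MemLp (fun x : ℝ => (x : ℂ)) 2 μ := hx.ofReal
  have hmc : ∫ x : ℝ, (x : ℂ) ∂μ = 0 := by
    rw [integral_complex_ofReal, hmean]; simp
  have hcov := norm_covariance_sq_le hxc (memLp_resolvent (μ := μ) hw 2)
  -- As the mean vanishes, this is the covariance of `x` with the resolvent, and it equals `-(F - w)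
  -- m`. Cauchy–Schwarz thus gives `|F - w|² ≤ s · Im (F - w) / Im w`, and one factor `|F - w|`
  -- cancels.
  have e1 : ∫ x : ℝ, (x : ℂ) * ((x : ℂ) - w)⁻¹ ∂μ = 1 + w * stieltjes μ w := by
    have : ∀ x : ℝ, (x : ℂ) * ((x : ℂ) - w)⁻¹ = 1 + w * ((x : ℂ) - w)⁻¹ := fun x => by
      have := ofReal_sub_ne_zero hw x
      field_simp
      ring
    simp_rw [this]
    rw [integral_add (integrable_const _) ((integrable_resolvent hw).const_mul _),
      integral_const_mul]
    simp [stieltjes]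
  have e2 : 1 + w * stieltjes μ w = -(subordinationPart μ w * stieltjes μ w) := by
    simp only [subordinationPart, negRecipStieltjes]
    field_simp
    ring
  have e3 : ∀ x : ℝ, ‖(x : ℂ)‖ ^ 2 = x ^ 2 := fun x => by simp
  simp_rw [e3] at hcov
  rw [e1, e2, hmc] at hcov
  simp only [zero_mul, sub_zero, norm_neg, norm_mul, norm_zero, mul_pow] at hcov
  change _ ≤ (_ - 0 ^ 2) * (_ - ‖stieltjes μ w‖ ^ 2) at hcov
  have ea := im_mul_variance_resolvent (μ := μ) hw
  set s := ∫ x, x ^ 2 ∂μ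
  have hs : 0 ≤ s := integral_nonneg fun x => sq_nonneg _
  have h1 : w.im * (‖subordinationPart μ w‖ ^ 2 * ‖stieltjes μ w‖ ^ 2)
      ≤ s * (‖stieltjes μ w‖ ^ 2 * (subordinationPart μ w).im) := by
    rw [← ea]
    nlinarith [mul_le_mul_of_nonneg_left hcov hw'.le]
  have h2 : (subordinationPart μ w).im ≤ ‖subordinationPart μ w‖ :=
    (le_abs_self _).trans (Complex.abs_im_le_norm _)
  have h3 : w.im * ‖subordinationPart μ w‖ ^ 2 ≤ s * ‖subordinationPart μ w‖ := by
    have h4 : w.im * ‖subordinationPart μ w‖ ^ 2 ≤ s * (subordinationPart μ w).im :=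
      le_of_mul_le_mul_right (by linarith) (by positivity : 0 < ‖stieltjes μ w‖ ^ 2)
    exact h4.trans (by gcongr)
  rw [le_div_iff₀ hw']
  rcases (norm_nonneg (subordinationPart μ w)).eq_or_lt with h0 | h0
  · rw [← h0]; simpa using hs
  · exact le_of_mul_le_mul_right (by linarith) h0

lemma differentiableOn_negRecipStieltjes :
    DifferentiableOn ℂ (negRecipStieltjes μ) upperHalf :=
  (differentiableOn_stieltjes.inv fun _ hw => stieltjes_ne_zero hw).neg

lemma differentiableOn_subordinationPart :
    DifferentiableOn ℂ (subordinationPart μ) upperHalf :=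
  differentiableOn_negRecipStieltjes.sub differentiableOn_id

end Nevanlinna

/-! ### The fixed-point equation for the first subordination function -/

/-- The properties of `w ↦ F_μ(w) - w` for a centred measure `μ` of variance `s` that govern the
subordination equation. -/
structure IsPickMap (h : ℂ → ℂ) (s : ℝ) : Prop where
  differentiableOn : DifferentiableOn ℂ h upperHalf
  im_nonneg : ∀ w ∈ upperHalf, 0 ≤ (h w).im
  schwarzPick : ∀ a ∈ upperHalf, ∀ b ∈ upperHalf,
    ‖h a - h b‖ ^ 2 * (a.im * b.im) ≤ ‖a - b‖ ^ 2 * ((h a).im * (h b).im)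
  norm_le : ∀ w ∈ upperHalf, ‖h w‖ ≤ s / w.im

/-- The map whose fixed point in the upper half-plane is the first subordination function at `z`,
when the second measure is `(δ_r + δ_{-r}) / 2`. -/
noncomputable def subordinationMap (h : ℂ → ℂ) (r : ℝ) (z ω : ℂ) : ℂ := z + h (z - r ^ 2 / ω)

lemma im_sub_sq_div (r : ℝ) (z ω : ℂ) :
    (z - (r : ℂ) ^ 2 / ω).im = z.im + r ^ 2 * ω.im / ‖ω‖ ^ 2 := by
  have : ((r : ℂ) ^ 2 / ω) = ((r ^ 2 : ℝ) : ℂ) * ω⁻¹ := by push_cast; rw [div_eq_mul_inv]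
  rw [this, Complex.sub_im, Complex.im_ofReal_mul, Complex.inv_im, Complex.normSq_eq_norm_sq]
  ring

lemma im_le_im_sub_sq_div (r : ℝ) (z : ℂ) {ω : ℂ} (hω : ω ∈ upperHalf) :
    z.im ≤ (z - (r : ℂ) ^ 2 / ω).im := by
  rw [im_sub_sq_div]
  have : 0 ≤ r ^ 2 * ω.im / ‖ω‖ ^ 2 := by
    have : 0 < ω.im := hω
    positivity
  linarith

lemma sub_sq_div_mem (r : ℝ) {z ω : ℂ} (hz : z ∈ upperHalf) (hω : ω ∈ upperHalf) :
    z - (r : ℂ) ^ 2 / ω ∈ upperHalf :=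
  lt_of_lt_of_le hz (im_le_im_sub_sq_div r z hω)

lemma ne_zero_of_mem_upperHalf {w : ℂ} (hw : w ∈ upperHalf) : w ≠ 0 := by
  rintro rfl
  simp [upperHalf] at hw

/-- The map `ω ↦ -r²/ω` gives equality; translating by `z` leaves the left side alone and increases
both imaginary parts on the right. -/
lemma sub_sq_div_schwarzPick (r : ℝ) {z a b : ℂ} (hz : z ∈ upperHalf) (ha : a ∈ upperHalf)
    (hb : b ∈ upperHalf) :
    ‖(z - (r : ℂ) ^ 2 / a) - (z - (r : ℂ) ^ 2 / b)‖ ^ 2 * (a.im * b.im)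
      ≤ ‖a - b‖ ^ 2 * ((z - (r : ℂ) ^ 2 / a).im * (z - (r : ℂ) ^ 2 / b).im) := by
  have ha0 := ne_zero_of_mem_upperHalf ha
  have hb0 := ne_zero_of_mem_upperHalf hb
  have ha' : 0 < a.im := ha
  have hb' : 0 < b.im := hb
  have hz' : 0 < z.im := hz
  have hna : 0 < ‖a‖ := norm_pos_iff.2 ha0
  have hnb : 0 < ‖b‖ := norm_pos_iff.2 hb0
  have e : (z - (r : ℂ) ^ 2 / a) - (z - (r : ℂ) ^ 2 / b) = (r : ℂ) ^ 2 * (a - b) / (a * b) := by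
    field_simp
    ring
  rw [e, im_sub_sq_div, im_sub_sq_div, norm_div, norm_mul, norm_mul, norm_pow, Complex.norm_real,
    Real.norm_eq_abs, sq_abs]
  calc (r ^ 2 * ‖a - b‖ / (‖a‖ * ‖b‖)) ^ 2 * (a.im * b.im)
      = ‖a - b‖ ^ 2 * ((r ^ 2 * a.im / ‖a‖ ^ 2) * (r ^ 2 * b.im / ‖b‖ ^ 2)) := by
        field_simp
    _ ≤ _ := by
        gcongr
        · linarith
        · linarith

namespace IsPickMap

variable {h : ℂ → ℂ} {s : ℝ} (H : IsPickMap h s) (r : ℝ)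
include H

lemma s_nonneg : 0 ≤ s := by
  have hI : Complex.I ∈ upperHalf := by simp [upperHalf]
  simpa using (norm_nonneg _).trans (H.norm_le _ hI)

lemma norm_subordinationMap_sub_le {ε : ℝ} (hε : 0 < ε) {z a : ℂ} (hz : ε ≤ z.im)
    (ha : a ∈ upperHalf) : ‖subordinationMap h r z a - z‖ ≤ s / ε := by
  have hz' : z ∈ upperHalf := lt_of_lt_of_le hε hz
  rw [subordinationMap, add_sub_cancel_left]
  refine (H.norm_le _ (sub_sq_div_mem r hz' ha)).trans ?_
  have := H.s_nonneg
  gcongr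
  exact hz.trans (im_le_im_sub_sq_div r z ha)

lemma im_le_im_subordinationMap {z a : ℂ} (hz : z ∈ upperHalf) (ha : a ∈ upperHalf) :
    z.im ≤ (subordinationMap h r z a).im := by
  have := H.im_nonneg _ (sub_sq_div_mem r hz ha)
  rw [subordinationMap, Complex.add_im]
  linarith

/-- Composing the two Schwarz–Pick inequalities bounds the left side using `Im h` instead of `Im (z
+ h)`. As `Im h ≤ s/ε` and `Im z ≥ ε`, replacing the former by the latter gains `(s/ε) / (s/ε + ε) <
1` at each point. The gain depends neither on `r` nor on the real part of `z`. -/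
lemma subordinationMap_contraction {ε : ℝ} (hε : 0 < ε) {z a b : ℂ}
    (hz : ε ≤ z.im) (ha : a ∈ upperHalf) (hb : b ∈ upperHalf) :
    ‖subordinationMap h r z a - subordinationMap h r z b‖ ^ 2 * (a.im * b.im)
      ≤ (s / ε / (s / ε + ε)) ^ 2 * (‖a - b‖ ^ 2 *
        ((subordinationMap h r z a).im * (subordinationMap h r z b).im)) := by
  have hz' : z ∈ upperHalf := lt_of_lt_of_le hε hz
  have ha' : 0 < a.im := ha
  have hb' : 0 < b.im := hb
  have hp := sub_sq_div_mem r hz' ha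
  have hq := sub_sq_div_mem r hz' hb
  have hp' : 0 < (z - (r : ℂ) ^ 2 / a).im := hp
  have hq' : 0 < (z - (r : ℂ) ^ 2 / b).im := hq
  have h1 := sub_sq_div_schwarzPick r hz' ha hb
  have h2 := H.schwarzPick _ hp _ hq
  have hsε : 0 ≤ s / ε := div_nonneg H.s_nonneg hε.le
  have hk : ∀ c ∈ upperHalf, (h (z - (r : ℂ) ^ 2 / c)).im
      ≤ s / ε / (s / ε + ε) * (subordinationMap h r z c).im := by
    intro c hc
    have h3 : (h (z - (r : ℂ) ^ 2 / c)).im ≤ s / ε := by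
      have := H.norm_subordinationMap_sub_le r hε hz hc
      rw [subordinationMap, add_sub_cancel_left] at this
      exact (le_abs_self _).trans ((Complex.abs_im_le_norm _).trans this)
    rw [subordinationMap, Complex.add_im, div_mul_eq_mul_div, le_div_iff₀ (by positivity)]
    nlinarith [mul_le_mul_of_nonneg_left hz hsε]
  have hka := hk a ha
  have hkb := hk b hb
  have h3 : ‖subordinationMap h r z a - subordinationMap h r z b‖ ^ 2 * (a.im * b.im)
      ≤ ‖a - b‖ ^ 2 * ((h (z - (r : ℂ) ^ 2 / a)).im * (h (z - (r : ℂ) ^ 2 / b)).im) := by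
    rw [subordinationMap, subordinationMap, add_sub_add_left_eq_sub]
    refine le_of_mul_le_mul_right ?_ (mul_pos hp' hq')
    have h4 := mul_le_mul_of_nonneg_right h2 (mul_pos ha' hb').le
    have h5 := mul_le_mul_of_nonneg_right h1
      (mul_nonneg (H.im_nonneg _ hp) (H.im_nonneg _ hq))
    linarith
  refine h3.trans ?_
  have h6 := mul_le_mul hka hkb (H.im_nonneg _ hq) ((H.im_nonneg _ hp).trans hka)
  calc _ ≤ ‖a - b‖ ^ 2 * _ := mul_le_mul_of_nonneg_left h6 (by positivity)
    _ = _ := by ring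

lemma ratio_mem {ε : ℝ} (hε : 0 < ε) : s / ε / (s / ε + ε) ∈ Ico (0 : ℝ) 1 := by
  have hsε : 0 ≤ s / ε := div_nonneg H.s_nonneg hε.le
  exact ⟨by positivity, by rw [div_lt_one (by positivity)]; linarith⟩

lemma fixedPoint_unique {z a b : ℂ} (hz : z ∈ upperHalf) (ha : a ∈ upperHalf)
    (hb : b ∈ upperHalf) (ha' : subordinationMap h r z a = a)
    (hb' : subordinationMap h r z b = b) : a = b := by
  have h1 := H.subordinationMap_contraction r hz le_rfl ha hb
  rw [ha', hb'] at h1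
  obtain ⟨k0, k1⟩ := H.ratio_mem hz
  set k := s / z.im / (s / z.im + z.im)
  have hab : 0 < a.im * b.im := mul_pos ha hb
  by_contra hne
  have : 0 < ‖a - b‖ ^ 2 := by
    have := norm_pos_iff.2 (sub_ne_zero.2 hne)
    positivity
  have h2 : 0 < ‖a - b‖ ^ 2 * (a.im * b.im) := by positivity
  have h3 : k ^ 2 < 1 := pow_lt_one₀ k0 k1 two_ne_zero
  nlinarith [mul_lt_mul_of_pos_right h3 h2]

/-- The iterates of the subordination map started at `z`. -/
noncomputable def _root_.subordinationIterate (h : ℂ → ℂ) (r : ℝ) (n : ℕ) (z : ℂ) : ℂ :=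
  (subordinationMap h r z)^[n] z

omit H in
lemma _root_.subordinationIterate_succ (n : ℕ) (z : ℂ) : subordinationIterate h r (n + 1) z
    = subordinationMap h r z (subordinationIterate h r n z) := by
  rw [subordinationIterate, Function.iterate_succ_apply', subordinationIterate]

lemma im_le_im_subordinationIterate (n : ℕ) {z : ℂ} (hz : z ∈ upperHalf) :
    z.im ≤ (subordinationIterate h r n z).im := by
  induction n with
  | zero => simp [subordinationIterate]
  | succ n ih =>
    rw [subordinationIterate_succ]
    exact H.im_le_im_subordinationMap r hz (lt_of_lt_of_le hz ih)

lemma subordinationIterate_mem (n : ℕ) {z : ℂ} (hz : z ∈ upperHalf) :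
    subordinationIterate h r n z ∈ upperHalf :=
  lt_of_lt_of_le hz (H.im_le_im_subordinationIterate r n hz)

lemma im_subordinationIterate_le {ε : ℝ} (hε : 0 < ε) (n : ℕ) {z : ℂ} (hz : ε ≤ z.im) :
    (subordinationIterate h r n z).im ≤ z.im + s / ε := by
  have hz' : z ∈ upperHalf := lt_of_lt_of_le hε hz
  have hs : 0 ≤ s / ε := div_nonneg H.s_nonneg hε.le
  cases n with
  | zero => simpa [subordinationIterate] using hs
  | succ n =>
    rw [subordinationIterate_succ]
    have h1 := H.norm_subordinationMap_sub_le r hε hz (H.subordinationIterate_mem r n hz')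
    have h2 := (le_abs_self _).trans ((Complex.abs_im_le_norm _).trans h1)
    rw [Complex.sub_im] at h2
    linarith

lemma differentiableOn_subordinationIterate (n : ℕ) :
    DifferentiableOn ℂ (subordinationIterate h r n) upperHalf := by
  induction n with
  | zero => exact differentiableOn_id
  | succ n ih =>
    have e : subordinationIterate h r (n + 1)
        = fun z => z + h (z - (r : ℂ) ^ 2 / subordinationIterate h r n z) := by
      ext z
      rw [subordinationIterate_succ, subordinationMap]
    rw [e]
    refine differentiableOn_id.add (H.differentiableOn.comp (differentiableOn_id.sub
      ((differentiableOn_const _).div ih fun z hz =>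
        ne_zero_of_mem_upperHalf (H.subordinationIterate_mem r n hz))) fun z hz =>
        sub_sq_div_mem r hz (H.subordinationIterate_mem r n hz))

/-- The contraction is in the quantity `|a - b|² / (Im a · Im b)`. It becomes a Euclidean estimate
because the heights of the iterates stay between `ε` and `M + s/ε`: the lower bound enters at the
first step, of length at most `s/ε`, and the upper bound at the end. Uniformity over a horizontal
strip is what makes the limit analytic. -/
lemma dist_subordinationIterate_le {ε M : ℝ} (hε : 0 < ε) (n : ℕ) {z : ℂ} (hz : ε ≤ z.im)
    (hM : z.im ≤ M) :
    dist (subordinationIterate h r n z) (subordinationIterate h r (n + 1) z)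
      ≤ (s / ε / ε * (M + s / ε)) * (s / ε / (s / ε + ε)) ^ n := by
  have hz' : z ∈ upperHalf := lt_of_lt_of_le hε hz
  have hs : 0 ≤ s / ε := div_nonneg H.s_nonneg hε.le
  obtain ⟨k0, k1⟩ := H.ratio_mem hε
  set k := s / ε / (s / ε + ε)
  set a := fun n => subordinationIterate h r n z with ha
  have hpos : ∀ n, 0 < (a n).im := fun n => H.subordinationIterate_mem r n hz'
  have hlow : ∀ n, ε ≤ (a n).im := fun n => hz.trans (H.im_le_im_subordinationIterate r n hz')
  have hup : ∀ n, (a n).im ≤ M + s / ε := fun n =>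
    (H.im_subordinationIterate_le r hε n hz).trans (by linarith)
  have key : ∀ n, ‖a (n + 1) - a n‖ ^ 2
      ≤ (s / ε / ε) ^ 2 * (k ^ n) ^ 2 * ((a (n + 1)).im * (a n).im) := by
    intro n
    induction n with
    | zero =>
      have h1 : ‖a 1 - a 0‖ ≤ s / ε := by
        have h0 : a 0 = z := rfl
        have h2 : a 1 = subordinationMap h r z z := rfl
        rw [h0, h2]
        exact H.norm_subordinationMap_sub_le r hε hz hz'
      calc ‖a (0 + 1) - a 0‖ ^ 2 ≤ (s / ε) ^ 2 := by gcongr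
        _ = (s / ε / ε) ^ 2 * (k ^ 0) ^ 2 * (ε * ε) := by field_simp
        _ ≤ _ := by
          gcongr
          · exact (hpos _).le
          · exact hlow _
          · exact hlow _
    | succ n ih =>
      have h1 := H.subordinationMap_contraction r hε hz (H.subordinationIterate_mem r (n + 1) hz')
        (H.subordinationIterate_mem r n hz')
      rw [← subordinationIterate_succ, ← subordinationIterate_succ] at h1
      change ‖a (n + 1 + 1) - a (n + 1)‖ ^ 2 * ((a (n + 1)).im * (a n).im)
        ≤ k ^ 2 * (‖a (n + 1) - a n‖ ^ 2 * ((a (n + 1 + 1)).im * (a (n + 1)).im)) at h1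
      have h2 := mul_pos (hpos (n + 1)) (hpos n)
      have h3 := mul_pos (hpos (n + 1 + 1)) (hpos (n + 1))
      refine le_of_mul_le_mul_right (h1.trans ?_) h2
      calc k ^ 2 * (‖a (n + 1) - a n‖ ^ 2 * ((a (n + 1 + 1)).im * (a (n + 1)).im))
          ≤ k ^ 2 * (((s / ε / ε) ^ 2 * (k ^ n) ^ 2 * ((a (n + 1)).im * (a n).im))
            * ((a (n + 1 + 1)).im * (a (n + 1)).im)) := by gcongr
        _ = _ := by ring
  rw [dist_comm, dist_eq_norm]
  have hM' : 0 ≤ M + s / ε := (hpos 0).le.trans (hup 0)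
  refine abs_le_of_sq_le_sq' ?_ (by positivity) |>.2
  refine (key n).trans ?_
  calc (s / ε / ε) ^ 2 * (k ^ n) ^ 2 * ((a (n + 1)).im * (a n).im)
      ≤ (s / ε / ε) ^ 2 * (k ^ n) ^ 2 * ((M + s / ε) * (M + s / ε)) := by
        have := (hpos n).le
        gcongr
        · exact hup _
        · exact hup _
    _ = _ := by ring

/-- The fixed point of the subordination map as the limit of its iterates. -/
noncomputable def _root_.subordinationFixedPoint (h : ℂ → ℂ) (r : ℝ) (z : ℂ) : ℂ :=
  limUnder atTop fun n => subordinationIterate h r n z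

lemma tendsto_subordinationIterate {z : ℂ} (hz : z ∈ upperHalf) :
    Tendsto (fun n => subordinationIterate h r n z) atTop (𝓝 (subordinationFixedPoint h r z)) :=
  (cauchySeq_of_le_geometric _ _ (H.ratio_mem hz).2 fun n =>
    H.dist_subordinationIterate_le r hz n le_rfl le_rfl).tendsto_limUnder

lemma im_le_im_subordinationFixedPoint {z : ℂ} (hz : z ∈ upperHalf) :
    z.im ≤ (subordinationFixedPoint h r z).im :=
  ge_of_tendsto' ((Complex.continuous_im.tendsto _).comp (H.tendsto_subordinationIterate r hz))
    fun n => H.im_le_im_subordinationIterate r n hz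

lemma subordinationFixedPoint_mem {z : ℂ} (hz : z ∈ upperHalf) :
    subordinationFixedPoint h r z ∈ upperHalf :=
  lt_of_lt_of_le hz (H.im_le_im_subordinationFixedPoint r hz)

lemma subordinationMap_fixedPoint {z : ℂ} (hz : z ∈ upperHalf) :
    subordinationMap h r z (subordinationFixedPoint h r z) = subordinationFixedPoint h r z := by
  have hω := H.subordinationFixedPoint_mem r hz
  have h1 : ContinuousAt (subordinationMap h r z) (subordinationFixedPoint h r z) := by
    have h2 : ContinuousAt h (z - (r : ℂ) ^ 2 / subordinationFixedPoint h r z) :=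
      H.differentiableOn.continuousOn.continuousAt
        (isOpen_upperHalf.mem_nhds (sub_sq_div_mem r hz hω))
    refine continuousAt_const.add (ContinuousAt.comp (f := fun ω => z - (r : ℂ) ^ 2 / ω) h2 ?_)
    exact continuousAt_const.sub
      (continuousAt_const.div continuousAt_id (ne_zero_of_mem_upperHalf hω))
  have h2 := h1.tendsto.comp (H.tendsto_subordinationIterate r hz)
  refine tendsto_nhds_unique h2 ?_
  have h3 := (tendsto_add_atTop_iff_nat 1).2 (H.tendsto_subordinationIterate r hz)
  simpa only [subordinationIterate_succ, Function.comp_def] using h3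

lemma differentiableOn_subordinationFixedPoint :
    DifferentiableOn ℂ (subordinationFixedPoint h r) upperHalf := by
  intro z hz
  have hz' : 0 < z.im := hz
  -- A strip suffices as neighbourhood, since the rate of convergence depends on `z` only through
  -- bounds on `Im z`.
  set U : Set ℂ := {w | z.im / 2 < w.im ∧ w.im < z.im + 1}
  have hU : IsOpen U := (isOpen_lt continuous_const Complex.continuous_im).inter
    (isOpen_lt Complex.continuous_im continuous_const)
  have hsub : U ⊆ upperHalf := fun w hw => lt_trans (half_pos hz') hw.1
  have hzU : z ∈ U := ⟨by linarith, by linarith⟩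
  obtain ⟨k0, k1⟩ := H.ratio_mem (half_pos hz')
  set k := s / (z.im / 2) / (s / (z.im / 2) + z.im / 2)
  have hunif : TendstoUniformlyOn (subordinationIterate h r) (subordinationFixedPoint h r)
      atTop U := by
    rw [Metric.tendstoUniformlyOn_iff]
    intro δ hδ
    set C := s / (z.im / 2) / (z.im / 2) * (z.im + 1 + s / (z.im / 2))
    have h1 : Tendsto (fun n : ℕ => C * k ^ n / (1 - k)) atTop (𝓝 0) := by
      simpa using ((tendsto_pow_atTop_nhds_zero_of_lt_one k0 k1).const_mul C).div_const (1 - k)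
    filter_upwards [h1.eventually_lt_const hδ] with n hn w hw
    rw [dist_comm]
    exact (dist_le_of_le_geometric_of_tendsto k C k1
      (fun n => H.dist_subordinationIterate_le r (half_pos hz') n hw.1.le hw.2.le)
      (H.tendsto_subordinationIterate r (hsub hw)) n).trans_lt hn
  have := hunif.tendstoLocallyUniformlyOn.differentiableOn
    (Eventually.of_forall fun n => (H.differentiableOn_subordinationIterate r n).mono hsub) hU
  exact (this.differentiableAt (hU.mem_nhds hzU)).differentiableWithinAt

end IsPickMap

/-! ### The Schwarz formula and the Herglotz representation on the disc -/

section Herglotz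

noncomputable instance : MeasurableSpace Circle := borel Circle

instance : BorelSpace Circle := ⟨rfl⟩

open Complex Metric Real ComplexConjugate

/-- On the unit circle `ζ / (ζ - z)` is the conjugate of `1 / (1 - z̄ ζ)`, so the integrand is the
conjugate of a function analytic on the closed disc, and the mean value property applies. -/
lemma circleAverage_mul_conj {f : ℂ → ℂ} {R : ℝ} (hR : 1 < R)
    (hf : DifferentiableOn ℂ f (ball 0 R)) {z : ℂ} (hz : z ∈ ball (0 : ℂ) 1) :
    circleAverage (fun ζ => ζ / (ζ - z) * conj (f ζ)) 0 1 = conj (f 0) := by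
  have hsub : closedBall (0 : ℂ) 1 ⊆ ball 0 R := closedBall_subset_ball hR
  have hz1 : ‖z‖ < 1 := by simpa using hz
  have hne : ∀ ζ ∈ closedBall (0 : ℂ) 1, 1 - conj z * ζ ≠ 0 := by
    intro ζ hζ h0
    have h1 : conj z * ζ = 1 := (sub_eq_zero.1 h0).symm
    have h2 := congrArg norm h1
    rw [norm_mul, RCLike.norm_conj, norm_one] at h2
    have h3 : ‖ζ‖ ≤ 1 := by simpa using hζ
    nlinarith [norm_nonneg z, norm_nonneg ζ]
  have hd : DiffContOnCl ℂ (fun ζ => (1 - conj z * ζ)⁻¹ * f ζ) (ball 0 |1|) := by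
    rw [abs_one]
    refine DifferentiableOn.diffContOnCl ?_
    rw [closure_ball _ one_ne_zero]
    exact (DifferentiableOn.inv (by fun_prop) hne).mul (hf.mono hsub)
  have h1 := hd.circleAverage
  have h2 : circleAverage (fun ζ => ζ / (ζ - z) * conj (f ζ)) 0 1
      = circleAverage (fun ζ => conj ((1 - conj z * ζ)⁻¹ * f ζ)) 0 1 := by
    refine circleAverage_congr_sphere fun ζ hζ => ?_
    have hζ1 : ‖ζ‖ = 1 := by simpa using hζ
    have hζ0 : ζ ≠ 0 := by rintro rfl; simp at hζ1
    have e : conj ζ = ζ⁻¹ := by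
      rw [Complex.inv_def, Complex.normSq_eq_norm_sq, hζ1]; simp
    simp only [map_mul, map_inv₀, map_sub, map_one, Complex.conj_conj, e]
    congr 1
    rw [← div_eq_mul_inv, one_sub_div hζ0, inv_div]
  rw [h2]
  have h3 : circleAverage (fun ζ => conj ((1 - conj z * ζ)⁻¹ * f ζ)) 0 1
      = conj (circleAverage (fun ζ => (1 - conj z * ζ)⁻¹ * f ζ) 0 1) := by
    have h4 : (0 : ℝ) ≤ 2 * π := by positivity
    simp only [circleAverage_def, intervalIntegral.integral_of_le h4, integral_conj,
      Complex.real_smul, map_mul (starRingEnd ℂ) (((2 * π)⁻¹ : ℝ) : ℂ), Complex.conj_ofReal]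
  rw [h3, h1]
  simp

/-- Schwarz integral formula on the unit disc. -/
lemma eq_circleAverage_im {f : ℂ → ℂ} {R : ℝ} (hR : 1 < R)
    (hf : DifferentiableOn ℂ f (ball 0 R)) {z : ℂ} (hz : z ∈ ball (0 : ℂ) 1) :
    f z = (f 0).re + I * circleAverage (fun ζ => (ζ + z) / (ζ - z) * ((f ζ).im : ℂ)) 0 1 := by
  have hsub : closedBall (0 : ℂ) 1 ⊆ ball 0 R := closedBall_subset_ball hR
  have hz1 : ‖z‖ < 1 := by simpa using hz
  have h0 : (0 : ℂ) ∈ ball (0 : ℂ) 1 := by simp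
  have hd : DiffContOnCl ℂ f (ball 0 |1|) := by
    rw [abs_one]
    refine DifferentiableOn.diffContOnCl ?_
    rw [closure_ball _ one_ne_zero]
    exact hf.mono hsub
  have hne : ∀ ζ ∈ sphere (0 : ℂ) 1, ζ - z ≠ 0 := by
    intro ζ hζ h
    have : ‖ζ‖ = 1 := by simpa using hζ
    rw [sub_eq_zero.1 h] at this
    linarith
  have hne0 : ∀ ζ ∈ sphere (0 : ℂ) 1, ζ ≠ 0 := by
    intro ζ hζ h
    simp [h] at hζ
  have hfc : ContinuousOn f (sphere 0 1) :=
    (hf.mono (sphere_subset_closedBall.trans hsub)).continuousOn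
  have hkc : ContinuousOn (fun ζ => ζ / (ζ - z)) (sphere (0 : ℂ) 1) :=
    continuousOn_id.div (by fun_prop) hne
  have hcc : ContinuousOn (fun ζ => conj (f ζ)) (sphere (0 : ℂ) 1) :=
    Complex.continuous_conj.comp_continuousOn hfc
  have ci : ∀ {g : ℂ → ℂ}, ContinuousOn g (sphere 0 1) → CircleIntegrable g 0 1 := fun hg =>
    hg.circleIntegrable zero_le_one
  have e1 : circleAverage (fun ζ => ζ / (ζ - z) * f ζ) 0 1 = f z := by
    simpa using hd.circleAverage_smul_div (by simpa using hz : z ∈ ball (0 : ℂ) |1|)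
  have e2 := circleAverage_mul_conj hR hf hz
  have e3 : circleAverage f 0 1 = f 0 := hd.circleAverage
  have e4 : circleAverage (fun ζ => conj (f ζ)) 0 1 = conj (f 0) := by
    rw [← circleAverage_mul_conj hR hf h0]
    refine circleAverage_congr_sphere fun ζ hζ => ?_
    have := hne0 ζ (by simpa using hζ)
    simp [this]
  -- The Schwarz kernel is twice the Cauchy kernel minus one, and `i Im f = (f - conj f) / 2`.
  have e5 : circleAverage (fun ζ => I * ((ζ + z) / (ζ - z) * ((f ζ).im : ℂ))) 0 1
      = circleAverage (fun ζ => (ζ / (ζ - z) * f ζ - ζ / (ζ - z) * conj (f ζ))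
        - (2⁻¹ : ℂ) • (f ζ - conj (f ζ))) 0 1 := by
    refine circleAverage_congr_sphere fun ζ hζ => ?_
    have h1 := hne ζ (by simpa using hζ)
    have h2 : f ζ - conj (f ζ) = 2 * (f ζ).im * I := by
      rw [Complex.sub_conj]; push_cast; ring
    rw [← mul_sub, h2]
    field_simp
    simp
    ring
  have e6 : circleAverage (fun ζ => I * ((ζ + z) / (ζ - z) * ((f ζ).im : ℂ))) 0 1
      = I * circleAverage (fun ζ => (ζ + z) / (ζ - z) * ((f ζ).im : ℂ)) 0 1 :=
    circleAverage_fun_smul (a := I) (f := fun ζ => (ζ + z) / (ζ - z) * ((f ζ).im : ℂ))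
  rw [← e6, e5, 
    circleAverage_fun_sub (f₁ := fun ζ => ζ / (ζ - z) * f ζ - ζ / (ζ - z) * conj (f ζ))
      (f₂ := fun ζ => (2⁻¹ : ℂ) • (f ζ - conj (f ζ)))
      (ci ((hkc.mul hfc).sub (hkc.mul hcc))) (ci ((hfc.sub hcc).const_smul (2⁻¹ : ℂ))),
    circleAverage_fun_sub (f₁ := fun ζ => ζ / (ζ - z) * f ζ)
      (f₂ := fun ζ => ζ / (ζ - z) * conj (f ζ)) (ci (hkc.mul hfc)) (ci (hkc.mul hcc)),
    circleAverage_fun_smul (f := fun ζ => f ζ - conj (f ζ)),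
    circleAverage_fun_sub (f₁ := f) (ci hfc) (ci hcc),
    e1, e2, e3, e4, Complex.sub_conj]
  have e7 : conj (f 0) = (f 0).re - (f 0).im * I := by
    apply Complex.ext <;> simp
  rw [e7]
  simp
  ring

/-- The rotation-invariant probability measure on the circle. -/
noncomputable def circleUniform : Measure Circle :=
  ENNReal.ofReal ((2 * π)⁻¹) • (volume.restrict (Ioc 0 (2 * π))).map Circle.exp

instance : IsProbabilityMeasure circleUniform := by
  constructor
  rw [circleUniform, Measure.smul_apply, Measure.map_apply Circle.exp.continuous.measurable
    MeasurableSet.univ]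
  simp only [preimage_univ, Measure.restrict_apply, MeasurableSet.univ, univ_inter,
    Real.volume_Ioc, sub_zero, smul_eq_mul]
  rw [← ENNReal.ofReal_mul (by positivity), inv_mul_cancel₀ (by positivity), ENNReal.ofReal_one]

lemma integral_circleUniform {g : ℂ → ℂ} (hg : Continuous fun ζ : Circle => g ζ) :
    ∫ ζ : Circle, g ζ ∂circleUniform = circleAverage g 0 1 := by
  rw [circleUniform, integral_smul_measure, integral_map Circle.exp.continuous.aemeasurable
    hg.aestronglyMeasurable, circleAverage_def, intervalIntegral.integral_of_le (by positivity),
    ENNReal.toReal_ofReal (by positivity)]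
  simp [circleMap]

/-- Herglotz representation of a holomorphic function with nonnegative imaginary part on the unit
disc. -/
lemma exists_herglotz_measure {g : ℂ → ℂ} (hg : DifferentiableOn ℂ g (ball 0 1))
    (him : ∀ z ∈ ball (0 : ℂ) 1, 0 ≤ (g z).im) :
    ∃ ν : Measure Circle, IsFiniteMeasure ν ∧ ∀ z ∈ ball (0 : ℂ) 1,
      g z = (g 0).re + I * ∫ ζ : Circle, ((ζ : ℂ) + z) / (ζ - z) ∂ν := by
  set ρ : ℕ → ℝ := fun n => 1 - 1 / ((n : ℝ) + 1) with hρ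
  have hρ0 : ∀ n, 0 ≤ ρ n := fun n => by
    have : 1 / ((n : ℝ) + 1) ≤ 1 := by
      rw [div_le_one (by positivity)]; linarith [n.cast_nonneg (α := ℝ)]
    simp only [hρ]; linarith
  have hρ1 : ∀ n, ρ n < 1 := fun n => by
    have : 0 < 1 / ((n : ℝ) + 1) := by positivity
    simp only [hρ]; linarith
  have hρt : Tendsto ρ atTop (𝓝 1) := by
    simpa [hρ] using tendsto_one_div_add_atTop_nhds_zero_nat.const_sub (1 : ℝ)
  have hmem : ∀ n, ∀ z : ℂ, ‖z‖ ≤ 1 → (ρ n : ℂ) * z ∈ ball (0 : ℂ) 1 := fun n z hz => by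
    rw [mem_ball_zero_iff, norm_mul, Complex.norm_real, Real.norm_eq_abs, abs_of_nonneg (hρ0 n)]
    nlinarith [hρ0 n, hρ1 n, norm_nonneg z]
  have hdiff : ∀ n, ∃ R : ℝ, 1 < R ∧ DifferentiableOn ℂ (fun ζ => g (ρ n * ζ)) (ball 0 R) := by
    intro n
    refine ⟨2 / (1 + ρ n), by rw [lt_div_iff₀ (by linarith [hρ0 n])]; linarith [hρ1 n], ?_⟩
    refine hg.comp (by fun_prop) fun ζ hζ => ?_
    rw [mem_ball_zero_iff] at hζ ⊢
    rw [norm_mul, Complex.norm_real, Real.norm_eq_abs, abs_of_nonneg (hρ0 n)]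
    rw [lt_div_iff₀ (by linarith [hρ0 n])] at hζ
    nlinarith [hρ0 n, hρ1 n, norm_nonneg ζ]
  have hcont : ∀ n, Continuous fun ζ : Circle => g (ρ n * ζ) := fun n =>
    hg.continuousOn.comp_continuous (by fun_prop) fun ζ => hmem n ζ ζ.norm_coe.le
  have hnn : ∀ n (ζ : Circle), 0 ≤ (g (ρ n * ζ)).im := fun n ζ => him _ (hmem n ζ ζ.norm_coe.le)
  set ν : ℕ → Measure Circle := fun n =>
    circleUniform.withDensity fun ζ => ENNReal.ofReal (g (ρ n * ζ)).im with hν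
  have hmeas : ∀ n, Measurable fun ζ : Circle => ENNReal.ofReal (g (ρ n * ζ)).im := fun n =>
    (Complex.continuous_im.comp (hcont n)).measurable.ennreal_ofReal
  have hint : ∀ n, ∀ F : ℂ → ℂ, (Continuous fun ζ : Circle => F ζ) →
      ∫ ζ : Circle, F ζ ∂(ν n) = circleAverage (fun ζ => F ζ * ((g (ρ n * ζ)).im : ℂ)) 0 1 := by
    intro n F hF
    rw [hν, integral_withDensity_eq_integral_toReal_smul (hmeas n)
      (Eventually.of_forall fun _ => ENNReal.ofReal_lt_top), ← integral_circleUniform]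
    · refine integral_congr_ae (Eventually.of_forall fun ζ => ?_)
      simp only [ENNReal.toReal_ofReal (hnn n ζ), Complex.real_smul]
      ring
    · exact hF.mul (Complex.continuous_ofReal.comp (Complex.continuous_im.comp (hcont n)))
  have hfin : ∀ n, IsFiniteMeasure (ν n) := fun n => by
    refine isFiniteMeasure_withDensity_ofReal ?_
    exact ((BoundedContinuousFunction.mkOfCompact
      ⟨_, Complex.continuous_im.comp (hcont n)⟩).integrable circleUniform).2
  -- The formula at `z = 0` shows that all the masses agree, which keeps the measures in a weakly
  -- compact set.
  have hmass : ∀ n, (ν n).real univ = (g 0).im := by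
    intro n
    have h1 := hint n (fun _ => 1) continuous_const
    obtain ⟨R, hR, hd⟩ := hdiff n
    have h2 := eq_circleAverage_im hR hd (z := 0) (by simp)
    have h3 : circleAverage (fun ζ => (ζ + 0) / (ζ - 0) * (((g (ρ n * ζ)).im : ℝ) : ℂ)) 0 1
        = circleAverage (fun ζ => 1 * (((g (ρ n * ζ)).im : ℝ) : ℂ)) 0 1 := by
      refine circleAverage_congr_sphere fun ζ hζ => ?_
      have : ζ ≠ 0 := by rintro rfl; simp at hζ
      simp [this]
    rw [h3, ← h1] at h2
    have h4 := congrArg Complex.im h2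
    simpa using h4.symm
  set P : ℕ → FiniteMeasure Circle := fun n => ⟨ν n, hfin n⟩
  have hK := isCompact_setOfPred_finiteMeasure_le_of_compactSpace Circle (g 0).im.toNNReal
  have hPK : ∀ n, P n ∈ {μ : FiniteMeasure Circle | μ.mass ≤ (g 0).im.toNNReal} := by
    intro n
    have : ((P n).mass : ℝ) = (g 0).im := hmass n
    change (P n).mass ≤ _
    rw [← NNReal.coe_le_coe, this]
    exact Real.le_coe_toNNReal _
  rw [isCompact_iff_ultrafilter_le_nhds'] at hK
  -- A limit along a free ultrafilter takes the place of a convergent subsequence.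
  obtain ⟨Q, -, hQ⟩ := hK ((hyperfilter ℕ).map P) (Ultrafilter.mem_map.2 (Filter.univ_mem' hPK))
  refine ⟨Q, inferInstance, fun z hz => ?_⟩
  have hz1 : ‖z‖ < 1 := by simpa using hz
  have hkc : Continuous fun ζ : Circle => ((ζ : ℂ) + z) / (ζ - z) := by
    refine Continuous.div (by fun_prop) (by fun_prop) fun ζ h => ?_
    have := ζ.norm_coe
    rw [sub_eq_zero.1 h] at this
    linarith
  have hconv := (FiniteMeasure.tendsto_iff_forall_integral_rclike_tendsto ℂ).1
    (show Tendsto P (hyperfilter ℕ) (𝓝 Q) from hQ) (BoundedContinuousFunction.mkOfCompact ⟨_, hkc⟩)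
  have h1 : ∀ n, g (ρ n * z) = (g 0).re + I * ∫ ζ : Circle, ((ζ : ℂ) + z) / (ζ - z) ∂(ν n) := by
    intro n
    obtain ⟨R, hR, hd⟩ := hdiff n
    have := eq_circleAverage_im hR hd hz
    rw [hint n (fun ζ => (ζ + z) / (ζ - z)) hkc]
    simpa using this
  have h2 : Tendsto (fun n => g (ρ n * z)) (hyperfilter ℕ) (𝓝 (g z)) := by
    have : Tendsto (fun n => (ρ n : ℂ) * z) atTop (𝓝 z) := by
      simpa using ((Complex.continuous_ofReal.tendsto 1).comp hρt).mul_const z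
    exact (((hg.continuousOn.continuousAt (isOpen_ball.mem_nhds hz)).tendsto.comp this)).mono_left
      Nat.hyperfilter_le_atTop
  have h3 := (hconv.const_mul I).const_add (((g 0).re : ℝ) : ℂ)
  refine tendsto_nhds_unique h2 ?_
  simp_rw [h1]
  exact h3

end Herglotz

/-! ### Stieltjes transforms of probability measures, characterised on the half-plane -/

section Representation

open Complex Metric Real ComplexConjugate

lemma norm_stieltjes_le_measureReal {μ : Measure ℝ} [IsFiniteMeasure μ] {w : ℂ}
    (hw : w ∈ upperHalf) : ‖stieltjes μ w‖ ≤ w.im⁻¹ * μ.real univ :=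
  norm_integral_le_of_norm_le_const (μ := μ) (Eventually.of_forall (norm_resolvent_le hw))

lemma I_mul_mem_upperHalf {η : ℝ} (hη : 0 < η) : I * (η : ℂ) ∈ upperHalf := by
  simpa [upperHalf] using hη

lemma tendsto_I_mul_stieltjes (μ : Measure ℝ) [IsFiniteMeasure μ] :
    Tendsto (fun η : ℝ => I * η * stieltjes μ (I * η)) atTop (𝓝 (-(μ.real univ : ℂ))) := by
  have h0 : -(μ.real univ : ℂ) = ∫ _ : ℝ, (-1 : ℂ) ∂μ := by simp
  rw [h0]
  have h1 : ∀ η : ℝ, I * η * stieltjes μ (I * η)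
      = ∫ x : ℝ, I * η * ((x : ℂ) - I * η)⁻¹ ∂μ := fun η => by
    rw [integral_const_mul, stieltjes]
  simp_rw [h1]
  refine tendsto_integral_filter_of_dominated_convergence (fun _ => 1) ?_ ?_
    (integrable_const _) ?_
  · filter_upwards [eventually_gt_atTop 0] with η hη
    exact ((continuous_resolvent (I_mul_mem_upperHalf hη)).const_mul _).aestronglyMeasurable
  · filter_upwards [eventually_gt_atTop 0] with η hη
    refine Eventually.of_forall fun x => ?_
    have := norm_resolvent_le (I_mul_mem_upperHalf hη) x
    rw [norm_mul]
    have e : ‖I * (η : ℂ)‖ = η := by simp [abs_of_pos hη]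
    rw [e]
    calc η * ‖((x : ℂ) - I * η)⁻¹‖ ≤ η * (I * (η : ℂ)).im⁻¹ := by gcongr
      _ = 1 := by simp [hη.ne']
  · refine Eventually.of_forall fun x => ?_
    have h2 : Tendsto (fun η : ℝ => (I * (x : ℂ)) * ((η⁻¹ : ℝ) : ℂ) + 1) atTop (𝓝 1) := by
      have := (Complex.continuous_ofReal.tendsto 0).comp tendsto_inv_atTop_zero
      simpa using (this.const_mul (I * (x : ℂ))).add_const 1
    have h3 : Tendsto (fun η : ℝ => -((I * (x : ℂ)) * ((η⁻¹ : ℝ) : ℂ) + 1)⁻¹) atTop (𝓝 (-1)) := by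
      simpa using (h2.inv₀ one_ne_zero).neg
    refine h3.congr' ?_
    filter_upwards [eventually_gt_atTop 0] with η hη
    have h4 := ofReal_sub_ne_zero (I_mul_mem_upperHalf hη) x
    have hη' : (η : ℂ) ≠ 0 := by exact_mod_cast hη.ne'
    have e : (I * (x : ℂ)) * ((η⁻¹ : ℝ) : ℂ) + 1 = I * ((x : ℂ) - I * η) * (η : ℂ)⁻¹ := by
      push_cast
      field_simp
      linear_combination (η : ℂ) * I_sq
    rw [e, mul_inv, mul_inv, inv_inv, Complex.inv_I]
    ring

lemma im_cayley (ζ : ℂ) (hζ : ζ ≠ 1) :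
    (I * (1 + ζ) / (1 - ζ)).im = (1 - ‖ζ‖ ^ 2) / ‖1 - ζ‖ ^ 2 := by
  have h : normSq (1 - ζ) ≠ 0 := by
    rw [ne_eq, normSq_eq_zero]
    exact sub_ne_zero.2 (Ne.symm hζ)
  rw [← normSq_eq_norm_sq, ← normSq_eq_norm_sq, Complex.div_im]
  field_simp
  simp [normSq_apply]
  ring

lemma circle_norm_sub_one_sq (ζ : Circle) :
    ((‖(ζ : ℂ) - 1‖ ^ 2 : ℝ) : ℂ) = -(1 - (ζ : ℂ)) ^ 2 / ζ := by
  have h0 := ζ.coe_ne_zero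
  have h1 : ((‖(ζ : ℂ) - 1‖ ^ 2 : ℝ) : ℂ) = ((ζ : ℂ) - 1) * conj ((ζ : ℂ) - 1) := by
    rw [Complex.mul_conj']; push_cast; rfl
  rw [h1, map_sub, ← Circle.coe_inv_eq_conj, Circle.coe_inv, map_one]
  field_simp
  ring

/-- The inverse Cayley transform on the unit circle. -/
noncomputable def circleToReal (ζ : Circle) : ℝ := -2 * (ζ : ℂ).im / ‖(ζ : ℂ) - 1‖ ^ 2

lemma measurable_circleToReal : Measurable circleToReal := by
  unfold circleToReal
  have h1 : Measurable fun ζ : Circle => -2 * (ζ : ℂ).im :=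
    (by fun_prop : Continuous fun ζ : Circle => -2 * (ζ : ℂ).im).measurable
  have h2 : Measurable fun ζ : Circle => ‖(ζ : ℂ) - 1‖ ^ 2 :=
    (by fun_prop : Continuous fun ζ : Circle => ‖(ζ : ℂ) - 1‖ ^ 2).measurable
  exact h1.div h2

lemma circleToReal_eq {ζ : Circle} (hζ : (ζ : ℂ) ≠ 1) :
    (circleToReal ζ : ℂ) = I * (1 + ζ) / (1 - ζ) := by
  have h0 := ζ.coe_ne_zero
  have h1 : (1 : ℂ) - ζ ≠ 0 := sub_ne_zero.2 (Ne.symm hζ)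
  have h2 : ((-2 * (ζ : ℂ).im : ℝ) : ℂ) = I * ((ζ : ℂ) - (ζ : ℂ)⁻¹) := by
    rw [← Circle.coe_inv, Circle.coe_inv_eq_conj, Complex.sub_conj]
    push_cast
    linear_combination -2 * ((ζ : ℂ).im : ℂ) * I_sq
  rw [circleToReal, Complex.ofReal_div, h2, circle_norm_sub_one_sq]
  field_simp
  ring

/-- With `x` the Cayley image of `ζ`, one has `4 / |ζ - 1|² = 1 + x²`, and the kernel becomes `(1 +
x w) / (x - w) = (1 + x²) / (x - w) - x`. The first term is a resolvent with a density, the second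
does not involve `w`. -/
lemma herglotz_kernel_eq {ζ : Circle} (hζ : (ζ : ℂ) ≠ 1) {w : ℂ} (hw : w ∈ upperHalf) :
    I * (((ζ : ℂ) + (w - I) / (w + I)) / (ζ - (w - I) / (w + I)))
      = ((4 / ‖(ζ : ℂ) - 1‖ ^ 2 : ℝ) : ℂ) * ((circleToReal ζ : ℂ) - w)⁻¹ - circleToReal ζ := by
  have h0 := ζ.coe_ne_zero
  have h1 : (1 : ℂ) - ζ ≠ 0 := sub_ne_zero.2 (Ne.symm hζ)
  have h2 := ofReal_sub_ne_zero hw (circleToReal ζ)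
  have h3 : w + I ≠ 0 := by
    intro h
    have h := congrArg Complex.im h
    have hw' : 0 < w.im := hw
    simp at h
    linarith
  rw [Complex.ofReal_div, circle_norm_sub_one_sq, circleToReal_eq hζ] at *
  have h4 : I * (1 + (ζ : ℂ)) - w * (1 - ζ) ≠ 0 := by
    intro h
    apply h2
    field_simp
    linear_combination h
  have h5 : (ζ : ℂ) * (w + I) - (w - I) ≠ 0 := by
    intro h
    apply h4
    linear_combination h
  have e1 : (ζ : ℂ) - (w - I) / (w + I) = ((ζ : ℂ) * (w + I) - (w - I)) / (w + I) := by
    field_simp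
  have e2 : I * (1 + (ζ : ℂ)) / (1 - ζ) - w = (I * (1 + (ζ : ℂ)) - w * (1 - ζ)) / (1 - ζ) := by
    field_simp
  have e3 : (ζ : ℂ) * (w + I) - (w - I) = I * (1 + (ζ : ℂ)) - w * (1 - ζ) := by ring
  rw [e1, e2, e3]
  push_cast
  field_simp
  ring_nf
  simp only [I_sq]
  ring

/-- A holomorphic self-map of the upper half-plane that behaves like `-1 / z` at infinity is the
Stieltjes transform of a probability measure. -/
theorem exists_probabilityMeasure_stieltjes_eq {m : ℂ → ℂ} (hm : DifferentiableOn ℂ m upperHalf)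
    (him : ∀ z ∈ upperHalf, 0 ≤ (m z).im) (hb : ∀ z ∈ upperHalf, ‖m z‖ ≤ z.im⁻¹)
    (hlim : Tendsto (fun η : ℝ => I * η * m (I * η)) atTop (𝓝 (-1))) :
    ∃ μ : Measure ℝ, IsProbabilityMeasure μ ∧ ∀ z ∈ upperHalf, stieltjes μ z = m z := by
  have hφ : ∀ ζ ∈ ball (0 : ℂ) 1, I * (1 + ζ) / (1 - ζ) ∈ upperHalf ∧ (1 : ℂ) - ζ ≠ 0 := by
    intro ζ hζ
    have h1 : ‖ζ‖ < 1 := by simpa using hζ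
    have h2 : ζ ≠ 1 := by rintro rfl; simp at h1
    have h3 : (1 : ℂ) - ζ ≠ 0 := sub_ne_zero.2 (Ne.symm h2)
    refine ⟨?_, h3⟩
    change 0 < (I * (1 + ζ) / (1 - ζ)).im
    rw [im_cayley ζ h2]
    have := norm_pos_iff.2 h3
    have : 0 < 1 - ‖ζ‖ ^ 2 := by nlinarith [norm_nonneg ζ]
    positivity
  obtain ⟨ν, hν, hrep⟩ := exists_herglotz_measure (g := fun ζ => m (I * (1 + ζ) / (1 - ζ)))
    (hm.comp (DifferentiableOn.div (by fun_prop) (by fun_prop) fun ζ hζ => (hφ ζ hζ).2)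
      fun ζ hζ => (hφ ζ hζ).1) fun ζ hζ => him _ (hφ ζ hζ).1
  have hwI : ∀ w ∈ upperHalf, w + I ≠ 0 := by
    intro w hw h
    have h := congrArg Complex.im h
    have hw' : 0 < w.im := hw
    simp at h
    linarith
  have hball : ∀ w ∈ upperHalf, (w - I) / (w + I) ∈ ball (0 : ℂ) 1 := by
    intro w hw
    have hw' : 0 < w.im := hw
    rw [mem_ball_zero_iff, norm_div, div_lt_one (norm_pos_iff.2 (hwI w hw))]
    refine lt_of_pow_lt_pow_left₀ 2 (norm_nonneg _) ?_
    rw [← normSq_eq_norm_sq, ← normSq_eq_norm_sq, normSq_apply, normSq_apply]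
    simp
    nlinarith
  have hinv : ∀ w ∈ upperHalf, I * (1 + (w - I) / (w + I)) / (1 - (w - I) / (w + I)) = w := by
    intro w hw
    have := hwI w hw
    have e : 1 - (w - I) / (w + I) = 2 * I / (w + I) := by field_simp; ring
    rw [e]
    have := I_ne_zero
    field_simp
    ring
  set a : ℝ := (m (I * (1 + 0) / (1 - 0))).re
  have hrep' : ∀ w ∈ upperHalf, m w = a + I * ∫ ζ : Circle,
      ((ζ : ℂ) + (w - I) / (w + I)) / (ζ - (w - I) / (w + I)) ∂ν := by
    intro w hw
    have := hrep _ (hball w hw)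
    simp only [hinv w hw] at this
    exact this
  have hKc : ∀ z ∈ ball (0 : ℂ) 1, Continuous fun ζ : Circle => ((ζ : ℂ) + z) / (ζ - z) := by
    intro z hz
    refine Continuous.div (by fun_prop) (by fun_prop) fun ζ h => ?_
    have h1 := ζ.norm_coe
    have h2 : ‖z‖ < 1 := by simpa using hz
    rw [sub_eq_zero.1 h] at h1
    linarith
  have hKi : ∀ z ∈ ball (0 : ℂ) 1, Integrable (fun ζ : Circle => ((ζ : ℂ) + z) / (ζ - z)) ν :=
    fun z hz => (BoundedContinuousFunction.mkOfCompact ⟨_, hKc z hz⟩).integrable ν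
  -- the density `4 / |ζ - 1|²` is integrable, by Fatou's lemma
  set D : Circle → ENNReal := fun ζ =>
    ENNReal.ofReal 4 * (ENNReal.ofReal (‖(ζ : ℂ) - 1‖ ^ 2))⁻¹ with hD
  have hDle : ∫⁻ ζ, D ζ ∂ν ≤ 1 := by
    -- `t n` is the Cayley image of `i (n + 1)`, and `c n` is chosen so that `∫ f n` equals `(n + 1)
    -- · Im m(i (n + 1))`, which the bound on `m` keeps below `1`.
    set t : ℕ → ℝ := fun n => ((n : ℝ) + 1 - 1) / ((n : ℝ) + 1 + 1) with ht
    have ht1 : Tendsto t atTop (𝓝 1) := by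
      have h1 : Tendsto (fun n : ℕ => 1 - 2 * (1 / (((n + 1 : ℕ) : ℝ) + 1))) atTop (𝓝 (1 - 2 * 0)) :=
        ((tendsto_one_div_add_atTop_nhds_zero_nat.comp (tendsto_add_atTop_nat 1)).const_mul
          2).const_sub 1
      simp only [mul_zero, sub_zero] at h1
      refine h1.congr fun n => ?_
      simp only [ht]
      push_cast
      field_simp
      ring
    set c : ℕ → ℝ := fun n => ((n : ℝ) + 1) * (1 - t n ^ 2) with hc
    have hceq : ∀ n, c n = (1 + t n) ^ 2 := by
      intro n
      simp only [hc, ht]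
      field_simp
      ring
    have hc1 : Tendsto c atTop (𝓝 4) := by
      have : Tendsto (fun n => (1 + t n) ^ 2) atTop (𝓝 ((1 + 1) ^ 2)) :=
        (ht1.const_add 1).pow 2
      norm_num at this
      exact this.congr fun n => (hceq n).symm
    set f : ℕ → Circle → ENNReal := fun n ζ =>
      ENNReal.ofReal (c n) * (ENNReal.ofReal (‖(ζ : ℂ) - t n‖ ^ 2))⁻¹ with hf
    have hfm : ∀ n, Measurable (f n) := by
      intro n
      refine Measurable.const_mul (Measurable.inv ?_) _
      exact (by fun_prop : Continuous fun ζ : Circle => ‖(ζ : ℂ) - t n‖ ^ 2).measurable.ennreal_ofReal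
    have hflim : ∀ ζ, Tendsto (fun n => f n ζ) atTop (𝓝 (D ζ)) := by
      intro ζ
      have h1 : Tendsto (fun n => ENNReal.ofReal (c n)) atTop (𝓝 (ENNReal.ofReal 4)) :=
        (ENNReal.continuous_ofReal.tendsto _).comp hc1
      have h2 : Tendsto (fun n => ‖(ζ : ℂ) - t n‖ ^ 2) atTop (𝓝 (‖(ζ : ℂ) - 1‖ ^ 2)) := by
        have h3 : Tendsto (fun n => (t n : ℂ)) atTop (𝓝 1) := by
          simpa [Function.comp_def] using (Complex.continuous_ofReal.tendsto 1).comp ht1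
        exact ((h3.const_sub _).norm).pow 2
      have h3 := tendsto_inv_iff.2 ((ENNReal.continuous_ofReal.tendsto _).comp h2)
      exact ENNReal.Tendsto.mul h1 (Or.inl (by simp)) h3 (Or.inr (by simp))
    have hfle : ∀ n, ∫⁻ ζ, f n ζ ∂ν ≤ 1 := by
      intro n
      have hη : (0 : ℝ) < (n : ℝ) + 1 := by positivity
      have hw := I_mul_mem_upperHalf hη
      have hz := hball _ hw
      have hzt : (I * (((n : ℝ) + 1 : ℝ) : ℂ) - I) / (I * (((n : ℝ) + 1 : ℝ) : ℂ) + I) = (t n : ℂ) := by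
        simp only [ht]
        push_cast
        have : (n : ℂ) + 1 + 1 ≠ 0 := by exact_mod_cast (by positivity : (n : ℝ) + 1 + 1 ≠ 0)
        have := I_ne_zero
        have e : I * ((n : ℂ) + 1) + I = I * ((n : ℂ) + 1 + 1) := by ring
        rw [e]
        field_simp
      have h1 := hrep' _ hw
      rw [hzt] at h1 hz
      have h2 : (m (I * (((n : ℝ) + 1 : ℝ) : ℂ))).im
          = ∫ ζ : Circle, (((ζ : ℂ) + t n) / (ζ - t n)).re ∂ν := by
        rw [h1]
        have := integral_re (hKi _ hz)
        simp only [RCLike.re_eq_complex_re] at this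
        rw [this]
        simp
      have htn : |t n| < 1 := by simpa using hz
      have hden : ∀ ζ : Circle, 0 < ‖(ζ : ℂ) - t n‖ ^ 2 := by
        intro ζ
        have h3 : (ζ : ℂ) - t n ≠ 0 := by
          intro h3
          have h4 := ζ.norm_coe
          rw [sub_eq_zero.1 h3, Complex.norm_real, Real.norm_eq_abs] at h4
          linarith
        have := norm_pos_iff.2 h3
        positivity
      have h3 : ∀ ζ : Circle, (((ζ : ℂ) + t n) / (ζ - t n)).re
          = (1 - t n ^ 2) / ‖(ζ : ℂ) - t n‖ ^ 2 := by
        intro ζ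
        have h4 := ζ.normSq_coe
        have h5 := (hden ζ).ne'
        rw [← normSq_eq_norm_sq] at h5 ⊢
        rw [Complex.div_re]
        field_simp
        rw [normSq_apply] at h4
        simp
        nlinarith
      have hcn : 0 ≤ c n := by rw [hceq]; positivity
      have h4 : ∀ ζ, f n ζ = ENNReal.ofReal (((n : ℝ) + 1) * (((ζ : ℂ) + t n) / (ζ - t n)).re) := by
        intro ζ
        rw [h3, hf]
        simp only
        rw [← ENNReal.ofReal_inv_of_pos (hden ζ), ← ENNReal.ofReal_mul hcn]
        congr 1
        simp only [hc]
        ring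
      have h5 : Integrable (fun ζ : Circle => (((ζ : ℂ) + t n) / (ζ - t n)).re) ν :=
        (hKi _ hz).re
      simp_rw [h4]
      rw [← ofReal_integral_eq_lintegral_ofReal (h5.const_mul _), integral_const_mul, ← h2]
      · refine ENNReal.ofReal_le_one.2 ?_
        have h6 := (le_abs_self _).trans ((Complex.abs_im_le_norm _).trans (hb _ hw))
        calc _ ≤ ((n : ℝ) + 1) * (I * (((n : ℝ) + 1 : ℝ) : ℂ)).im⁻¹ := by gcongr
          _ = 1 := by simp [hη.ne']
      · refine Eventually.of_forall fun ζ => ?_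
        have := hden ζ
        have h7 : 0 ≤ 1 - t n ^ 2 := by nlinarith [abs_lt.1 htn]
        simp only [Pi.zero_apply, h3]
        positivity
    calc ∫⁻ ζ, D ζ ∂ν = ∫⁻ ζ, liminf (fun n => f n ζ) atTop ∂ν := by
          exact lintegral_congr fun ζ => (hflim ζ).liminf_eq.symm
      _ ≤ liminf (fun n => ∫⁻ ζ, f n ζ ∂ν) atTop := lintegral_liminf_le hfm
      _ ≤ 1 := liminf_le_of_le ⟨0, by simp⟩ fun b hb => by
          obtain ⟨n, hn⟩ := hb.exists
          exact hn.trans (hfle n)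
  have hDm : Measurable D :=
    (by fun_prop : Continuous fun ζ : Circle =>
      ‖(ζ : ℂ) - 1‖ ^ 2).measurable.ennreal_ofReal.inv.const_mul _
  have hDfin : ∀ᵐ ζ ∂ν, D ζ < ⊤ :=
    ae_lt_top hDm (ne_top_of_le_ne_top ENNReal.one_ne_top hDle)
  -- The point `ζ = 1` corresponds to infinity, and an atom there would add a term linear in `w`.
  -- The density is infinite at that point, so there is none.
  have hne : ∀ᵐ ζ : Circle ∂ν, (ζ : ℂ) ≠ 1 := by
    filter_upwards [hDfin] with ζ hζ h
    simp [hD, h] at hζ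
  have hDreal : ∀ ζ : Circle, (ζ : ℂ) ≠ 1 → (D ζ).toReal = 4 / ‖(ζ : ℂ) - 1‖ ^ 2 := by
    intro ζ hζ
    have h1 : 0 < ‖(ζ : ℂ) - 1‖ ^ 2 := by
      have := norm_pos_iff.2 (sub_ne_zero.2 hζ)
      positivity
    simp only [hD]
    rw [← ENNReal.ofReal_inv_of_pos h1, ← ENNReal.ofReal_mul (by norm_num),
      ENNReal.toReal_ofReal (by positivity)]
    rfl
  set μ₀ := ν.withDensity D with hμ₀
  have : IsFiniteMeasure μ₀ :=
    isFiniteMeasure_withDensity (ne_top_of_le_ne_top ENNReal.one_ne_top hDle)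
  set μ := μ₀.map circleToReal with hμ
  have : IsFiniteMeasure μ := by rw [hμ]; infer_instance
  have hst : ∀ w ∈ upperHalf, stieltjes μ w
      = ∫ ζ, (D ζ).toReal • ((circleToReal ζ : ℂ) - w)⁻¹ ∂ν := by
    intro w hw
    rw [stieltjes, hμ, integral_map measurable_circleToReal.aemeasurable
      (continuous_resolvent hw).aestronglyMeasurable, hμ₀,
      integral_withDensity_eq_integral_toReal_smul hDm hDfin]
  have hsti : ∀ w ∈ upperHalf, Integrable
      (fun ζ => (D ζ).toReal • ((circleToReal ζ : ℂ) - w)⁻¹) ν := by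
    intro w hw
    refine (integrable_withDensity_iff_integrable_smul' hDm hDfin).1 ?_
    exact (integrable_map_measure (continuous_resolvent hw).aestronglyMeasurable
      measurable_circleToReal.aemeasurable).1 (integrable_resolvent (μ := μ) hw)
  have hker : ∀ w ∈ upperHalf, (fun ζ : Circle => (circleToReal ζ : ℂ)) =ᵐ[ν] fun ζ =>
      (D ζ).toReal • ((circleToReal ζ : ℂ) - w)⁻¹
        - I * (((ζ : ℂ) + (w - I) / (w + I)) / (ζ - (w - I) / (w + I))) := by
    intro w hw
    filter_upwards [hne] with ζ hζ
    rw [herglotz_kernel_eq hζ hw, hDreal ζ hζ, Complex.real_smul]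
    ring
  -- The term `x` is a difference of two integrable functions and does not depend on `w`, so `m` and
  -- the transform of `μ` differ by a constant. Decay along the imaginary axis makes it zero.
  obtain ⟨b, hb'⟩ : ∃ b : ℂ, ∀ w ∈ upperHalf, m w = b + stieltjes μ w := by
    refine ⟨a - ∫ ζ, (circleToReal ζ : ℂ) ∂ν, fun w hw => ?_⟩
    rw [hrep' w hw, integral_congr_ae (hker w hw),
      integral_sub (hsti w hw) ((hKi _ (hball w hw)).const_mul I), integral_const_mul, hst w hw]
    ring
  have hb0 : b = 0 := by
    have h1 : Tendsto (fun η : ℝ => η⁻¹ * (1 + μ.real univ)) atTop (𝓝 0) := by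
      simpa using tendsto_inv_atTop_zero.mul_const (1 + μ.real univ)
    refine norm_le_zero_iff.1 (ge_of_tendsto h1 ?_)
    filter_upwards [eventually_gt_atTop 0] with η hη
    have hw := I_mul_mem_upperHalf hη
    have h2 : b = m (I * η) - stieltjes μ (I * η) := by rw [hb' _ hw]; ring
    have h3 := hb _ hw
    have h4 := norm_stieltjes_le_measureReal (μ := μ) hw
    have e : (I * (η : ℂ)).im = η := by simp
    rw [e] at h3 h4
    rw [h2]
    refine (norm_sub_le _ _).trans ?_
    linarith
  have hmass : μ.real univ = 1 := by
    have h1 := tendsto_I_mul_stieltjes μ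
    have h2 : Tendsto (fun η : ℝ => I * η * m (I * η)) atTop (𝓝 (-(μ.real univ : ℂ))) := by
      refine h1.congr' ?_
      filter_upwards [eventually_gt_atTop 0] with η hη
      rw [hb' _ (I_mul_mem_upperHalf hη), hb0, zero_add]
    have h3 := tendsto_nhds_unique h2 hlim
    exact_mod_cast neg_inj.1 h3
  refine ⟨μ, ⟨?_⟩, fun z hz => by rw [hb' z hz, hb0, zero_add]⟩
  rw [← ENNReal.toReal_eq_one_iff]
  exact hmass

end Representation

/-! ### Stieltjes inversion -/

section Inversion

open Real

lemma add_I_mul_mem_upperHalf (x : ℝ) {η : ℝ} (hη : 0 < η) :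
    (x : ℂ) + Complex.I * η ∈ upperHalf := by
  simpa [upperHalf] using hη

lemma tendsto_arctan_div_nhdsGT_zero (c : ℝ) :
    Tendsto (fun η : ℝ => arctan (c / η)) (𝓝[>] 0) (𝓝 (π / 2 * SignType.sign c)) := by
  rcases lt_trichotomy c 0 with hc | rfl | hc
  · have h1 : Tendsto (fun η : ℝ => c / η) (𝓝[>] 0) atBot :=
      tendsto_inv_nhdsGT_zero.const_mul_atTop_of_neg hc
    have h2 := tendsto_arctan_atBot.mono_right nhdsWithin_le_nhds |>.comp h1
    simpa [hc, Function.comp_def] using h2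
  · simp
  · have h1 : Tendsto (fun η : ℝ => c / η) (𝓝[>] 0) atTop :=
      tendsto_inv_nhdsGT_zero.const_mul_atTop hc
    have h2 := tendsto_arctan_atTop.mono_right nhdsWithin_le_nhds |>.comp h1
    simpa [hc, Function.comp_def] using h2

lemma integral_im_resolvent (s a b : ℝ) {η : ℝ} (hη : 0 < η) :
    ∫ x in a..b, (((s : ℂ) - (x + Complex.I * η))⁻¹).im
      = arctan ((b - s) / η) - arctan ((a - s) / η) := by
  have hd : ∀ x ∈ uIcc a b, HasDerivAt (fun x => arctan ((x - s) / η))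
      ((((s : ℂ) - (x + Complex.I * η))⁻¹).im) x := by
    intro x _
    have h1 := (((hasDerivAt_id x).sub_const s).div_const η).arctan
    convert! h1 using 1
    rw [Complex.inv_im, Complex.normSq_apply]
    simp
    have : 0 < η ^ 2 + (x - s) ^ 2 := by positivity
    have : (s - x) * (s - x) + η * η ≠ 0 := by nlinarith
    field_simp
    ring
  have hc : Continuous fun x : ℝ => (((s : ℂ) - (x + Complex.I * η))⁻¹).im :=
    Complex.continuous_im.comp ((by fun_prop : Continuous fun x : ℝ =>
      (s : ℂ) - (x + Complex.I * η)).inv₀ fun x =>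
        ofReal_sub_ne_zero (add_I_mul_mem_upperHalf x hη) s)
  rw [intervalIntegral.integral_eq_sub_of_hasDerivAt hd (hc.intervalIntegrable _ _)]

lemma integral_im_stieltjes (μ : Measure ℝ) [IsFiniteMeasure μ] {a b : ℝ} (hab : a ≤ b) {η : ℝ}
    (hη : 0 < η) :
    ∫ x in a..b, (stieltjes μ (x + Complex.I * η)).im
      = ∫ s, (arctan ((b - s) / η) - arctan ((a - s) / η)) ∂μ := by
  have h1 : ∀ x : ℝ, (stieltjes μ (x + Complex.I * η)).im
      = ∫ s : ℝ, (((s : ℂ) - (x + Complex.I * η))⁻¹).im ∂μ := fun x =>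
    (integral_im (integrable_resolvent (add_I_mul_mem_upperHalf x hη))).symm
  simp_rw [h1]
  rw [intervalIntegral.integral_of_le hab, integral_integral_swap]
  · refine integral_congr_ae (Eventually.of_forall fun s => ?_)
    simp only
    rw [← intervalIntegral.integral_of_le hab, integral_im_resolvent s a b hη]
  · have hc : Continuous fun p : ℝ × ℝ => (((p.2 : ℂ) - (p.1 + Complex.I * η))⁻¹).im :=
      Complex.continuous_im.comp ((by fun_prop : Continuous fun p : ℝ × ℝ =>
        (p.2 : ℂ) - (p.1 + Complex.I * η)).inv₀ fun p =>
          ofReal_sub_ne_zero (add_I_mul_mem_upperHalf p.1 hη) p.2)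
    refine Integrable.of_bound hc.aestronglyMeasurable η⁻¹ (Eventually.of_forall fun p => ?_)
    refine (Complex.abs_im_le_norm _).trans ?_
    simpa using norm_resolvent_le (add_I_mul_mem_upperHalf p.1 hη) p.2

lemma tendsto_integral_im_stieltjes (μ : Measure ℝ) [IsFiniteMeasure μ] {a b : ℝ} (hab : a ≤ b) :
    Tendsto (fun η : ℝ => ∫ x in a..b, (stieltjes μ (x + Complex.I * η)).im) (𝓝[>] 0)
      (𝓝 (∫ s, (π / 2 * SignType.sign (b - s) - π / 2 * SignType.sign (a - s)) ∂μ)) := by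
  have h : Tendsto (fun η : ℝ => ∫ s, (arctan ((b - s) / η) - arctan ((a - s) / η)) ∂μ) (𝓝[>] 0)
      (𝓝 (∫ s, (π / 2 * SignType.sign (b - s) - π / 2 * SignType.sign (a - s)) ∂μ)) := by
    refine tendsto_integral_filter_of_dominated_convergence (fun _ => π) ?_ ?_
      (integrable_const _) ?_
    · refine Eventually.of_forall fun η => Continuous.aestronglyMeasurable ?_
      exact (continuous_arctan.comp (by fun_prop)).sub (continuous_arctan.comp (by fun_prop))
    · refine Eventually.of_forall fun η => Eventually.of_forall fun s => ?_
      rw [norm_eq_abs, abs_le]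
      constructor <;> linarith [arctan_lt_pi_div_two ((b - s) / η), neg_pi_div_two_lt_arctan
        ((b - s) / η), arctan_lt_pi_div_two ((a - s) / η), neg_pi_div_two_lt_arctan ((a - s) / η)]
    · exact Eventually.of_forall fun s =>
        (tendsto_arctan_div_nhdsGT_zero _).sub (tendsto_arctan_div_nhdsGT_zero _)
  refine h.congr' ?_
  filter_upwards [self_mem_nhdsWithin] with η hη
  exact (integral_im_stieltjes μ hab hη).symm

/-- The integrand is `π` inside the interval, `π / 2` at its endpoints and `0` outside. Bounding it
by two indicators postpones the question of atoms at the endpoints. -/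
lemma measureReal_Ioo_le_integral_sign (μ : Measure ℝ) [IsFiniteMeasure μ] {a b : ℝ} (hab : a < b) :
    π * μ.real (Ioo a b)
        ≤ ∫ s, (π / 2 * SignType.sign (b - s) - π / 2 * SignType.sign (a - s)) ∂μ ∧
      ∫ s, (π / 2 * SignType.sign (b - s) - π / 2 * SignType.sign (a - s)) ∂μ
        ≤ π * μ.real (Icc a b) := by
  have hpi := pi_pos
  have hval : ∀ s : ℝ, (Ioo a b).indicator (fun _ => π) s
      ≤ π / 2 * SignType.sign (b - s) - π / 2 * SignType.sign (a - s) ∧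
      π / 2 * SignType.sign (b - s) - π / 2 * SignType.sign (a - s)
        ≤ (Icc a b).indicator (fun _ => π) s := by
    intro s
    rcases lt_trichotomy s a with h | h | h <;> rcases lt_trichotomy s b with h' | h' | h' <;>
      simp only [indicator, mem_Ioo, mem_Icc] <;>
      constructor <;> split_ifs <;>
      first
        | (exfalso; simp_all; done)
        | (exfalso; grind)
        | (simp [sign_pos, *]; try linarith)
  have hm : ∀ c : ℝ, Measurable fun s : ℝ => ((SignType.sign (c - s) : SignType) : ℝ) := by
    intro c
    have : (fun s : ℝ => ((SignType.sign (c - s) : SignType) : ℝ))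
        = fun s => (Iio c).indicator (fun _ => (1 : ℝ)) s - (Ioi c).indicator (fun _ => (1 : ℝ)) s := by
      ext s
      rcases lt_trichotomy s c with h | h | h
      · simp [h, h.le]
      · simp [h]
      · simp [h, h.le]
    rw [this]
    exact (measurable_const.indicator measurableSet_Iio).sub
      (measurable_const.indicator measurableSet_Ioi)
  have hi : Integrable
      (fun s => π / 2 * (SignType.sign (b - s) : ℝ) - π / 2 * SignType.sign (a - s)) μ := by
    refine Integrable.of_bound (C := π)
      (((hm b).const_mul _).sub ((hm a).const_mul _)).aestronglyMeasurable
      (Eventually.of_forall fun s => ?_)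
    rw [norm_eq_abs, abs_le]
    obtain ⟨h1, h2⟩ := hval s
    have h3 : 0 ≤ (Ioo a b).indicator (fun _ => π) s := indicator_nonneg (fun _ _ => hpi.le) s
    have h4 : (Icc a b).indicator (fun _ => π) s ≤ π := indicator_le_self' (fun _ _ => hpi.le) s
    constructor <;> linarith
  have e : ∀ A : Set ℝ, MeasurableSet A → π * μ.real A = ∫ s, A.indicator (fun _ => π) s ∂μ := by
    intro A hA
    rw [integral_indicator_const _ hA, smul_eq_mul, mul_comm]
  constructor
  · rw [e _ measurableSet_Ioo]
    exact integral_mono ((integrable_const _).indicator measurableSet_Ioo) hi fun s => (hval s).1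
  · rw [e _ measurableSet_Icc]
    exact integral_mono hi ((integrable_const _).indicator measurableSet_Icc) fun s => (hval s).2

/-- Stieltjes inversion: if the Stieltjes transform extends continuously to a real neighbourhood
of `0`, then the measure has a continuous density there. -/
theorem hasDensityAt_of_continuousOn {μ : Measure ℝ} [IsFiniteMeasure μ] {M : ℂ → ℂ} {δ : ℝ}
    (hδ : 0 < δ) (hM : ContinuousOn M (Metric.ball 0 δ))
    (heq : ∀ z ∈ Metric.ball 0 δ, z ∈ upperHalf → stieltjes μ z = M z) :
    HasDensityAt μ 0 ((M 0).im / π) := by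
  have hpi := pi_pos
  set f : ℝ → ℝ := fun x => (M x).im / π with hf
  have hfc : ContinuousOn f (Ioo (-δ) δ) := by
    refine (Complex.continuous_im.comp_continuousOn (hM.comp (by fun_prop) ?_)).div_const _
    intro x hx
    simpa [abs_lt] using hx
  have hshift : ∀ x : ℝ, Tendsto (fun η : ℝ => (x : ℂ) + Complex.I * η) (𝓝[>] 0) (𝓝 x) := by
    intro x
    have h1 : Continuous fun η : ℝ => (x : ℂ) + Complex.I * η := by fun_prop
    simpa using (h1.tendsto 0).mono_left nhdsWithin_le_nhds
  have hlim : ∀ x ∈ Ioo (-δ) δ, Tendsto (fun η : ℝ => (stieltjes μ (x + Complex.I * η)).im)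
      (𝓝[>] 0) (𝓝 (M x).im) := by
    intro x hx
    have hxb : (x : ℂ) ∈ Metric.ball (0 : ℂ) δ := by simpa [abs_lt] using hx
    have h1 := (hM.continuousAt (Metric.isOpen_ball.mem_nhds hxb)).tendsto.comp (hshift x)
    refine ((Complex.continuous_im.tendsto _).comp h1).congr' ?_
    filter_upwards [self_mem_nhdsWithin,
      (hshift x).eventually (Metric.isOpen_ball.mem_nhds hxb)] with η hη hb
    simp only [Function.comp_apply]
    rw [heq _ hb (add_I_mul_mem_upperHalf x hη)]
  have hnn : ∀ x ∈ Ioo (-δ) δ, 0 ≤ f x := by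
    intro x hx
    refine div_nonneg (ge_of_tendsto (hlim x hx) ?_) hpi.le
    filter_upwards [self_mem_nhdsWithin] with η hη
    have hw := add_I_mul_mem_upperHalf x hη
    rw [im_stieltjes hw]
    exact mul_nonneg (le_of_lt hw) (integral_nonneg fun s => by positivity)
  have hint : ∀ a b : ℝ, -δ < a → a < b → b < δ →
      ∫ s, (π / 2 * SignType.sign (b - s) - π / 2 * SignType.sign (a - s)) ∂μ
        = π * ∫ x in a..b, f x := by
    intro a b ha hab hb
    refine tendsto_nhds_unique (tendsto_integral_im_stieltjes μ hab.le) ?_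
    have e : π * ∫ x in a..b, f x = ∫ x in a..b, (M x).im := by
      rw [← intervalIntegral.integral_const_mul]
      congr 1
      ext x
      simp only [hf]
      field_simp
    rw [e]
    -- The room between `[a, b]` and the circle of radius `δ'` lets the segment be lifted by a small
    -- `η` inside a compact ball, where `M` is bounded.
    obtain ⟨δ', h1, h2⟩ := exists_between (max_lt (neg_lt.1 ha) hb)
    have hsub : Metric.closedBall (0 : ℂ) δ' ⊆ Metric.ball 0 δ := Metric.closedBall_subset_ball h2
    obtain ⟨C, hC⟩ := (isCompact_closedBall (0 : ℂ) δ').exists_bound_of_continuousOn (hM.mono hsub)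
    have hxabs : ∀ x ∈ uIoc a b, |x| ≤ max (-a) b := by
      intro x hx
      rw [uIoc_of_le hab.le] at hx
      exact abs_le'.2 ⟨hx.2.trans (le_max_right _ _), (by linarith [hx.1] : -x ≤ -a).trans
        (le_max_left _ _)⟩
    have hev : ∀ᶠ η : ℝ in 𝓝[>] 0, 0 < η ∧ ∀ x ∈ uIoc a b,
        (x : ℂ) + Complex.I * η ∈ Metric.closedBall (0 : ℂ) δ' := by
      have h3 : Iio (δ' - max (-a) b) ∈ 𝓝 (0 : ℝ) := Iio_mem_nhds (by linarith)
      filter_upwards [self_mem_nhdsWithin, nhdsWithin_le_nhds h3] with η hη hη'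
      refine ⟨hη, fun x hx => ?_⟩
      have hη0 : (0 : ℝ) < η := hη
      rw [mem_closedBall_zero_iff]
      refine (norm_add_le _ _).trans ?_
      have h4 := hxabs x hx
      have h5 : η < δ' - max (-a) b := hη'
      simp only [Complex.norm_real, norm_eq_abs, norm_mul, Complex.norm_I, one_mul, abs_of_pos hη0]
      linarith
    have hIoo : ∀ x ∈ uIoc a b, x ∈ Ioo (-δ) δ := by
      intro x hx
      rw [uIoc_of_le hab.le] at hx
      exact ⟨ha.trans hx.1, hx.2.trans_lt hb⟩
    refine intervalIntegral.tendsto_integral_filter_of_dominated_convergence (fun _ => C) ?_ ?_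
      intervalIntegrable_const ?_
    · filter_upwards [self_mem_nhdsWithin] with η hη
      refine Continuous.aestronglyMeasurable (Complex.continuous_im.comp ?_)
      exact differentiableOn_stieltjes.continuousOn.comp_continuous (by fun_prop) fun x =>
        add_I_mul_mem_upperHalf x hη
    · filter_upwards [hev] with η hη
      refine Eventually.of_forall fun x hx => ?_
      rw [heq _ (hsub (hη.2 x hx)) (add_I_mul_mem_upperHalf x hη.1)]
      exact (Complex.abs_im_le_norm _).trans (hC _ (hη.2 x hx))
    · exact Eventually.of_forall fun x hx => hlim x (hIoo x hx)
  have hle : ∀ a b : ℝ, -δ < a → a < b → b < δ →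
      μ.real (Ioo a b) ≤ ∫ x in a..b, f x ∧ ∫ x in a..b, f x ≤ μ.real (Icc a b) := by
    intro a b ha hab hb
    obtain ⟨h1, h2⟩ := measureReal_Ioo_le_integral_sign μ hab
    rw [hint a b ha hab hb] at h1 h2
    exact ⟨le_of_mul_le_mul_left h1 hpi, le_of_mul_le_mul_left h2 hpi⟩
  -- The mass of a point is at most that of a shrinking interval around it, which is at most an
  -- integral of `f` tending to zero.
  have hatom : ∀ a ∈ Ioo (-δ) δ, μ {a} = 0 := by
    intro a ha
    have h1 : Tendsto (fun ε : ℝ => ∫ x in (a - ε)..(a + ε), f x) (𝓝[>] 0) (𝓝 0) := by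
      have hfa : ContinuousAt f a := hfc.continuousAt (Ioo_mem_nhds ha.1 ha.2)
      obtain ⟨C, hC⟩ := (hfa.tendsto.norm.isBoundedUnder_le).eventually_le
      obtain ⟨ε₀, hε₀, hball⟩ := Metric.eventually_nhds_iff_ball.1 hC
      have h2 : Tendsto (fun ε : ℝ => C * |a + ε - (a - ε)|) (𝓝[>] 0) (𝓝 0) := by
        have : Continuous fun ε : ℝ => C * |a + ε - (a - ε)| := by fun_prop
        simpa using (this.tendsto 0).mono_left nhdsWithin_le_nhds
      refine squeeze_zero_norm' ?_ h2
      filter_upwards [Ioo_mem_nhdsGT hε₀] with ε hε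
      refine intervalIntegral.norm_integral_le_of_norm_le_const fun x hx => hball x ?_
      rw [uIoc_of_le (by linarith [hε.1])] at hx
      rw [Metric.mem_ball, dist_eq, abs_lt]
      constructor <;> linarith [hx.1, hx.2, hε.2]
    have h3 : μ.real {a} ≤ 0 := by
      refine ge_of_tendsto h1 ?_
      have h4 : Ioo 0 (min (a + δ) (δ - a)) ∈ 𝓝[>] (0 : ℝ) :=
        Ioo_mem_nhdsGT (lt_min (by linarith [ha.1]) (by linarith [ha.2]))
      filter_upwards [h4] with ε hε
      have h5 := lt_min_iff.1 hε.2
      refine le_trans (measureReal_mono ?_) (hle (a - ε) (a + ε) (by linarith) (by linarith [hε.1])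
        (by linarith)).1
      simpa using hε.1
    rw [← measureReal_eq_zero_iff]
    exact le_antisymm h3 measureReal_nonneg
  have hIoo : ∀ a b : ℝ, -δ < a → a < b → b < δ →
      μ (Ioo a b) = ENNReal.ofReal (∫ x in a..b, f x) := by
    intro a b ha hab hb
    obtain ⟨h1, h2⟩ := hle a b ha hab hb
    have h3 : μ (Icc a b) = μ (Ioo a b) := by
      refine measure_congr (Ioo_ae_eq_Icc' ?_ ?_).symm
      · exact hatom a ⟨ha, hab.trans hb⟩
      · exact hatom b ⟨ha.trans hab, hb⟩
    have h4 : μ.real (Icc a b) = μ.real (Ioo a b) := by simp only [Measure.real, h3]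
    rw [h4] at h2
    rw [← le_antisymm h1 h2, ofReal_measureReal]
  -- Halving the radius keeps the endpoints of every clipped interval strictly inside `(-δ, δ)`, as
  -- the interval formula requires.
  refine ⟨Ioo (-(δ / 2)) (δ / 2), f, isOpen_Ioo, ⟨by linarith, by linarith⟩,
    hfc.mono (Ioo_subset_Ioo (by linarith) (by linarith)),
    fun y hy => hnn y ⟨by linarith [hy.1], by linarith [hy.2]⟩, ?_, by simp [hf]⟩
  refine Real.measure_ext_Ioo_rat fun a b => ?_
  rw [Measure.restrict_apply measurableSet_Ioo, withDensity_apply _ measurableSet_Ioo,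
    Measure.restrict_restrict measurableSet_Ioo, Ioo_inter_Ioo]
  set a' : ℝ := max (a : ℝ) (-(δ / 2))
  set b' : ℝ := min (b : ℝ) (δ / 2)
  rcases le_or_gt b' a' with h | h
  · simp [Ioo_eq_empty_of_le h]
  · have ha' : -δ < a' := lt_of_lt_of_le (by linarith) (le_max_right _ _)
    have hb' : b' < δ := lt_of_le_of_lt (min_le_right _ _) (by linarith)
    have hsub : Icc a' b' ⊆ Ioo (-δ) δ := fun x hx => ⟨ha'.trans_le hx.1, hx.2.trans_lt hb'⟩
    rw [hIoo a' b' ha' h hb', intervalIntegral.integral_of_le h.le,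
      integral_Ioc_eq_integral_Ioo, ofReal_integral_eq_lintegral_ofReal]
    · exact ((hfc.mono hsub).integrableOn_Icc).mono_set Ioo_subset_Icc_self
    · refine (ae_restrict_iff' measurableSet_Ioo).2 (Eventually.of_forall fun x hx => ?_)
      exact hnn x (hsub (Ioo_subset_Icc_self hx))

end Inversion

/-! ### Symmetrized measures -/

section Symmetrization

variable {μ : Measure ℝ}

instance [IsProbabilityMeasure μ] : IsProbabilityMeasure (symmetrization μ) := by
  constructor
  rw [symmetrization, Measure.smul_apply, Measure.add_apply,
    Measure.map_apply measurable_neg MeasurableSet.univ]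
  simp only [preimage_univ, measure_univ, smul_eq_mul]
  rw [one_add_one_eq_two, ENNReal.inv_mul_cancel two_ne_zero ENNReal.ofNat_ne_top]

lemma integral_symmetrization {E : Type*} [NormedAddCommGroup E] [NormedSpace ℝ E] {f : ℝ → E}
    (hf : Continuous f) (h1 : Integrable f μ) (h2 : Integrable (fun x => f (-x)) μ) :
    ∫ x, f x ∂(symmetrization μ) = (2⁻¹ : ℝ) • ∫ x, (f x + f (-x)) ∂μ := by
  have h3 : Integrable f (μ.map fun x => -x) :=
    (integrable_map_measure hf.aestronglyMeasurable measurable_neg.aemeasurable).2 h2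
  rw [symmetrization, integral_smul_measure, integral_add_measure h1 h3,
    integral_map measurable_neg.aemeasurable hf.aestronglyMeasurable, integral_add h1 h2]
  simp

lemma symmetrization_ae_abs_le {s : ℝ} (h : ∀ᵐ x ∂μ, |x| ≤ s) :
    ∀ᵐ x ∂(symmetrization μ), |x| ≤ s := by
  simp only [ae_iff, not_le] at h ⊢
  rw [symmetrization, Measure.smul_apply, Measure.add_apply,
    Measure.map_apply measurable_neg (measurableSet_lt measurable_const (by fun_prop) : MeasurableSet {x : ℝ | s < |x|})]
  have e : (fun x : ℝ => -x) ⁻¹' {x | s < |x|} = {x | s < |x|} := by ext x; simp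
  rw [e, h]
  simp

lemma stieltjes_symmetrization [IsFiniteMeasure μ] {w : ℂ} (hw : w ∈ upperHalf) :
    stieltjes (symmetrization μ) w
      = (2⁻¹ : ℝ) • ∫ x : ℝ, (((x : ℂ) - w)⁻¹ + (((-x : ℝ) : ℂ) - w)⁻¹) ∂μ := by
  rw [stieltjes, integral_symmetrization (continuous_resolvent hw) (integrable_resolvent hw)]
  exact Integrable.of_bound ((continuous_resolvent hw).comp continuous_neg).aestronglyMeasurable _
    (Eventually.of_forall fun x => norm_resolvent_le hw (-x))

lemma neg_conj_mem_upperHalf {w : ℂ} (hw : w ∈ upperHalf) :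
    -(starRingEnd ℂ) w ∈ upperHalf := by
  simpa [upperHalf] using hw

/-- Reflection in the imaginary axis exchanges the contributions of `x` and `-x`. This equivariance
later forces `ω₁(iη)` to be purely imaginary. -/
lemma stieltjes_symmetrization_neg_conj [IsFiniteMeasure μ] {w : ℂ} (hw : w ∈ upperHalf) :
    stieltjes (symmetrization μ) (-(starRingEnd ℂ) w)
      = -(starRingEnd ℂ) (stieltjes (symmetrization μ) w) := by
  rw [stieltjes_symmetrization (neg_conj_mem_upperHalf hw), stieltjes_symmetrization hw,
    Complex.real_smul, Complex.real_smul, map_mul, Complex.conj_ofReal, ← integral_conj,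
    ← mul_neg, ← integral_neg]
  congr 2
  ext x
  have e1 : (x : ℂ) - -(starRingEnd ℂ) w = -((((-x : ℝ)) : ℂ) - (starRingEnd ℂ) w) := by
    push_cast; ring
  have e2 : (((-x : ℝ)) : ℂ) - -(starRingEnd ℂ) w = -((x : ℂ) - (starRingEnd ℂ) w) := by
    push_cast; ring
  rw [e1, e2, inv_neg, inv_neg]
  simp only [map_add, map_inv₀, map_sub, Complex.conj_ofReal]
  ring

lemma subordinationPart_symmetrization_neg_conj [IsFiniteMeasure μ] {w : ℂ} (hw : w ∈ upperHalf) :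
    subordinationPart (symmetrization μ) (-(starRingEnd ℂ) w)
      = -(starRingEnd ℂ) (subordinationPart (symmetrization μ) w) := by
  simp only [subordinationPart, negRecipStieltjes, stieltjes_symmetrization_neg_conj hw, map_sub,
    map_neg, map_inv₀, inv_neg]
  ring

lemma stieltjes_symmetrization_dirac (r : ℝ) {w : ℂ} (hw : w ∈ upperHalf) :
    stieltjes (symmetrization (Measure.dirac r)) w = w / (r ^ 2 - w ^ 2) := by
  have h1 := ofReal_sub_ne_zero hw r
  have h2 := ofReal_sub_ne_zero hw (-r)
  rw [stieltjes_symmetrization hw, integral_dirac, Complex.real_smul]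
  have e : (r : ℂ) ^ 2 - w ^ 2 = -(((r : ℂ) - w) * (((-r : ℝ) : ℂ) - w)) := by push_cast; ring
  rw [e]
  field_simp
  push_cast
  ring

/-- This explicit form eliminates `ω₂` from the subordination system. -/
lemma negRecipStieltjes_symmetrization_dirac (r : ℝ) {w : ℂ} (hw : w ∈ upperHalf) :
    negRecipStieltjes (symmetrization (Measure.dirac r)) w = w - r ^ 2 / w := by
  have h0 := ne_zero_of_mem_upperHalf hw
  rw [negRecipStieltjes, stieltjes_symmetrization_dirac r hw, inv_div]
  field_simp
  ring

section Bounded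

variable [IsProbabilityMeasure μ] {s : ℝ} (h : ∀ᵐ x ∂μ, |x| ≤ s)
include h

lemma memLp_id_of_ae_abs_le (p : ENNReal) : MemLp (fun x : ℝ => x) p μ :=
  MemLp.of_bound measurable_id.aestronglyMeasurable s h

lemma integral_id_symmetrization : ∫ x, x ∂(symmetrization μ) = 0 := by
  have h1 := (memLp_id_of_ae_abs_le h 1).integrable le_rfl
  rw [integral_symmetrization (f := fun x => x) continuous_id h1 h1.neg]
  simp

lemma integral_sq_symmetrization :
    ∫ x, x ^ 2 ∂(symmetrization μ) = ∫ x, x ^ 2 ∂μ := by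
  have h1 := (memLp_id_of_ae_abs_le h 2).integrable_sq
  rw [integral_symmetrization (by fun_prop) h1 (by simpa using h1)]
  simp only [even_two, Even.neg_pow, smul_eq_mul]
  rw [integral_add h1 h1]
  ring

lemma isPickMap_subordinationPart_symmetrization :
    IsPickMap (subordinationPart (symmetrization μ)) (∫ x, x ^ 2 ∂μ) where
  differentiableOn := differentiableOn_subordinationPart
  im_nonneg _ hw := subordinationPart_im_nonneg hw
  schwarzPick _ ha _ hb := subordinationPart_schwarzPick ha hb
  norm_le w hw := by
    have hs := symmetrization_ae_abs_le h
    rw [← integral_sq_symmetrization h]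
    exact norm_subordinationPart_le (memLp_id_of_ae_abs_le hs 2) (integral_id_symmetrization h) hw

end Bounded

end Symmetrization

/-! ### Explicit formulas on the imaginary axis -/

section ImaginaryAxis

/-- The integral `∫ (x² + t)⁻¹ dμ(x)`. -/
noncomputable def poissonMoment (μ : Measure ℝ) (t : ℝ) : ℝ := ∫ x, (x ^ 2 + t)⁻¹ ∂μ

variable {μ : Measure ℝ}

lemma abs_inv_sq_add_le {t : ℝ} (ht : 0 < t) (x : ℝ) : ‖(x ^ 2 + t)⁻¹‖ ≤ t⁻¹ := by
  rw [norm_inv, Real.norm_eq_abs, abs_of_pos (by positivity)]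
  exact inv_anti₀ ht (by nlinarith [sq_nonneg x])

lemma continuous_inv_sq_add {t : ℝ} (ht : 0 < t) : Continuous fun x : ℝ => (x ^ 2 + t)⁻¹ :=
  (by fun_prop : Continuous fun x : ℝ => x ^ 2 + t).inv₀ fun x => by positivity

lemma memLp_inv_sq_add [IsFiniteMeasure μ] {t : ℝ} (ht : 0 < t) (p : ENNReal) :
    MemLp (fun x : ℝ => (x ^ 2 + t)⁻¹) p μ :=
  MemLp.of_bound (continuous_inv_sq_add ht).aestronglyMeasurable _
    (Eventually.of_forall (abs_inv_sq_add_le ht))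

lemma integrable_inv_sq_add [IsFiniteMeasure μ] {t : ℝ} (ht : 0 < t) :
    Integrable (fun x : ℝ => (x ^ 2 + t)⁻¹) μ := (memLp_inv_sq_add ht 1).integrable le_rfl

lemma poissonMoment_antitone [IsFiniteMeasure μ] {t u : ℝ} (ht : 0 < t) (htu : t ≤ u) :
    poissonMoment μ u ≤ poissonMoment μ t :=
  integral_mono (integrable_inv_sq_add (ht.trans_le htu)) (integrable_inv_sq_add ht) fun x =>
    inv_anti₀ (by positivity) (by linarith)

lemma poissonMoment_pos [IsProbabilityMeasure μ] {t : ℝ} (ht : 0 < t) : 0 < poissonMoment μ t := by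
  rw [poissonMoment, integral_pos_iff_support_of_nonneg (fun x => by positivity)
    (integrable_inv_sq_add ht)]
  have : (Function.support fun x : ℝ => (x ^ 2 + t)⁻¹) = univ := by
    ext x
    have : x ^ 2 + t ≠ 0 := by positivity
    simpa using this
  rw [this]
  simp

lemma stieltjes_symmetrization_I_mul [IsProbabilityMeasure μ] {y : ℝ} (hy : 0 < y) :
    stieltjes (symmetrization μ) (Complex.I * y)
      = Complex.I * ((y * poissonMoment μ (y ^ 2) : ℝ) : ℂ) := by
  have hw := I_mul_mem_upperHalf hy
  rw [stieltjes_symmetrization hw, poissonMoment, ← integral_const_mul, Complex.real_smul,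
    ← integral_complex_ofReal, ← integral_const_mul, ← integral_const_mul]
  congr 1
  ext x
  have h1 := ofReal_sub_ne_zero hw x
  have h2 := ofReal_sub_ne_zero hw (-x)
  have h3 : ((x ^ 2 + y ^ 2 : ℝ) : ℂ) ≠ 0 := by
    exact_mod_cast (by positivity : (x ^ 2 + y ^ 2 : ℝ) ≠ 0)
  push_cast at h1 h2 h3 ⊢
  field_simp
  ring_nf
  simp only [Complex.I_pow_three]
  ring

lemma subordinationPart_I_mul [IsProbabilityMeasure μ] {y : ℝ} (hy : 0 < y) :
    subordinationPart (symmetrization μ) (Complex.I * y)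
      = Complex.I * (((y * poissonMoment μ (y ^ 2))⁻¹ - y : ℝ) : ℂ) := by
  rw [subordinationPart, negRecipStieltjes, stieltjes_symmetrization_I_mul hy, mul_inv,
    Complex.inv_I]
  push_cast
  ring

/-- The function `t ↦ 1 / ∫ (x² + t)⁻¹ dμ(x) - t` at `t = y²`. -/
lemma mul_im_subordinationPart_I_mul [IsProbabilityMeasure μ] {y : ℝ} (hy : 0 < y) :
    y * (subordinationPart (symmetrization μ) (Complex.I * y)).im
      = (poissonMoment μ (y ^ 2))⁻¹ - y ^ 2 := by
  have := poissonMoment_pos (μ := μ) (pow_pos hy 2)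
  rw [subordinationPart_I_mul hy]
  simp only [Complex.mul_im, Complex.I_re, Complex.I_im, Complex.ofReal_re, Complex.ofReal_im]
  field_simp
  ring

end ImaginaryAxis

/-! ### The two radii and the comparison of `G(y)` with `R²` -/

section Radii

variable {μ : Measure ℝ}

lemma support_nontrivial_of_not_ae_eq (p : ℝ) (h : ∀ᵐ x ∂μ, x = p) : ¬ μ.support.Nontrivial := by
  have h1 : μ.support ⊆ {p} := Measure.support_subset_of_isClosed isClosed_singleton h
  exact fun hn => (hn.mono h1).not_subsingleton subsingleton_singleton

lemma ae_mem_Icc_of_support_subset {s : ℝ} (h : μ.support ⊆ Icc 0 s) : ∀ᵐ x ∂μ, x ∈ Icc 0 s :=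
  mem_of_superset Measure.support_mem_ae h

lemma restrict_Ici_zero (h : ∀ᵐ x ∂μ, (0 : ℝ) ≤ x) : μ.restrict (Ici 0) = μ :=
  Measure.restrict_eq_self_of_ae_mem h

lemma outerRadius_sq (h : ∀ᵐ x ∂μ, (0 : ℝ) ≤ x) : outerRadius μ ^ 2 = ∫ x, x ^ 2 ∂μ := by
  rw [outerRadius, restrict_Ici_zero h, Real.sq_sqrt (integral_nonneg fun x => sq_nonneg x)]

lemma outerRadius_nonneg : 0 ≤ outerRadius μ := Real.sqrt_nonneg _

lemma innerRadius_nonneg : 0 ≤ innerRadius μ := ENNReal.toReal_nonneg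

variable [IsProbabilityMeasure μ]

lemma lintegral_inv_sq_ne_zero : ∫⁻ x, (ENNReal.ofReal (x ^ 2))⁻¹ ∂μ ≠ 0 := by
  intro h
  rw [lintegral_eq_zero_iff (by fun_prop)] at h
  obtain ⟨x, hx⟩ := h.exists
  simp at hx

/-- The inner radius is below `R` iff the integral of `x⁻²` exceeds `R⁻²`. -/
lemma innerRadius_lt_iff (h : ∀ᵐ x ∂μ, (0 : ℝ) ≤ x) {R : ℝ} (hR : 0 < R) :
    innerRadius μ < R ↔ ENNReal.ofReal ((R ^ 2)⁻¹) < ∫⁻ x, (ENNReal.ofReal (x ^ 2))⁻¹ ∂μ := by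
  rw [innerRadius, restrict_Ici_zero h]
  have h0 := lintegral_inv_sq_ne_zero (μ := μ)
  set L := ∫⁻ x, (ENNReal.ofReal (x ^ 2))⁻¹ ∂μ
  have htop : L ^ (-(1 / 2) : ℝ) ≠ ⊤ := by
    rw [ne_eq, ENNReal.rpow_eq_top_iff]
    rintro (⟨h1, -⟩ | ⟨-, h1⟩)
    · exact h0 h1
    · norm_num at h1
  rw [← ENNReal.lt_ofReal_iff_toReal_lt htop, ENNReal.rpow_neg, ENNReal.inv_lt_iff_inv_lt, one_div,
    ENNReal.lt_rpow_inv_iff two_pos, ← ENNReal.ofReal_inv_of_pos hR,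
    ENNReal.ofReal_rpow_of_nonneg (by positivity) two_pos.le]
  norm_num [inv_pow]

/-- Monotone convergence of `1 / (x² + u)` to `x⁻²` as `u` decreases to `0`; working in `[0, ∞]`
covers a divergent integral and an atom at `0` as well. -/
lemma exists_lt_poissonMoment {c : ℝ}
    (h : ENNReal.ofReal c < ∫⁻ x, (ENNReal.ofReal (x ^ 2))⁻¹ ∂μ) :
    ∃ t, 0 < t ∧ c < poissonMoment μ t := by
  set u : ℕ → ℝ := fun n => 1 / ((n : ℝ) + 1) with hu
  have hupos : ∀ n, 0 < u n := fun n => by simp only [hu]; positivity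
  have hlim : Tendsto (fun n => ∫⁻ x, (ENNReal.ofReal (x ^ 2 + u n))⁻¹ ∂μ) atTop
      (𝓝 (∫⁻ x, (ENNReal.ofReal (x ^ 2))⁻¹ ∂μ)) := by
    refine lintegral_tendsto_of_tendsto_of_monotone (fun n => by fun_prop)
      (Eventually.of_forall fun x n m hnm => ?_) (Eventually.of_forall fun x => ?_)
    · simp only
      gcongr
      simp only [hu]
      gcongr
    · have h1 : Tendsto (fun n => x ^ 2 + u n) atTop (𝓝 (x ^ 2)) := by
        simpa [hu] using tendsto_one_div_add_atTop_nhds_zero_nat.const_add (x ^ 2)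
      exact tendsto_inv_iff.2 ((ENNReal.continuous_ofReal.tendsto _).comp h1)
  obtain ⟨n, hn⟩ := (hlim.eventually_const_lt h).exists
  refine ⟨u n, hupos n, ?_⟩
  have e : ∫⁻ x, (ENNReal.ofReal (x ^ 2 + u n))⁻¹ ∂μ = ENNReal.ofReal (poissonMoment μ (u n)) := by
    rw [poissonMoment, ofReal_integral_eq_lintegral_ofReal (integrable_inv_sq_add (hupos n))]
    · refine lintegral_congr fun x => ?_
      have := hupos n
      rw [ENNReal.ofReal_inv_of_pos (by positivity)]
    · refine Eventually.of_forall fun x => ?_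
      have := hupos n
      simp only [Pi.zero_apply]
      positivity
  rw [e] at hn
  exact (ENNReal.ofReal_lt_ofReal_iff (poissonMoment_pos (hupos n))).1 hn

/-- Below some height, `1 / ∫ (x² + y²)⁻¹ dμ(x) - y²` is less than `R²` for `R > r₋`. -/
lemma exists_forall_mul_im_subordinationPart_lt (h : ∀ᵐ x ∂μ, (0 : ℝ) ≤ x) {R : ℝ} (hR : 0 < R)
    (hlt : innerRadius μ < R) :
    ∃ y₀ : ℝ, 0 < y₀ ∧ ∀ y : ℝ, 0 < y → y ≤ y₀ →
      y * (subordinationPart (symmetrization μ) (Complex.I * y)).im < R ^ 2 := by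
  -- `R > r₋` says `∫ x⁻² > R⁻²`; a single `t` with `∫ (x² + t)⁻¹ > R⁻²` suffices, since the
  -- integral only grows as `t` decreases.
  obtain ⟨t, ht, hct⟩ := exists_lt_poissonMoment ((innerRadius_lt_iff h hR).1 hlt)
  refine ⟨√t, Real.sqrt_pos.2 ht, fun y hy hyt => ?_⟩
  rw [mul_im_subordinationPart_I_mul hy]
  have h1 : y ^ 2 ≤ t := by
    calc y ^ 2 ≤ √t ^ 2 := by gcongr
      _ = t := Real.sq_sqrt ht.le
  have h2 := hct.trans_le (poissonMoment_antitone (μ := μ) (pow_pos hy 2) h1)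
  have h3 := inv_strictAnti₀ (by positivity) h2
  rw [inv_inv] at h3
  have : 0 < y ^ 2 := by positivity
  linarith

/-- Above some height, `1 / ∫ (x² + y²)⁻¹ dμ(x) - y²` is greater than `R²` for `R < r₊`. -/
lemma exists_forall_lt_mul_im_subordinationPart {s : ℝ} (h : ∀ᵐ x ∂μ, x ∈ Icc 0 s) {R : ℝ}
    (hR : 0 ≤ R) (hlt : R < outerRadius μ) :
    ∃ y₀ : ℝ, 0 < y₀ ∧ ∀ y : ℝ, y₀ ≤ y →
      R ^ 2 < y * (subordinationPart (symmetrization μ) (Complex.I * y)).im := by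
  have hA := outerRadius_sq (h.mono fun x hx => hx.1)
  have habs : ∀ᵐ x ∂μ, |x| ≤ s := h.mono fun x hx => by rw [abs_of_nonneg hx.1]; exact hx.2
  set A := outerRadius μ ^ 2
  have hAB : 0 < A - R ^ 2 := by
    have : R ^ 2 < A := pow_lt_pow_left₀ hlt hR two_ne_zero
    linarith
  -- With `t = y²` and `P = ∫ (x² + t)⁻¹`, one has `1/P - t = (1/P)(1 - tP) ≥ t · A / (s² + t)`,
  -- which exceeds `R²` once `t > s² R² / (A - R²)`. The added `1` ensures `y² ≥ y`.
  refine ⟨s ^ 2 * R ^ 2 / (A - R ^ 2) + 1, by positivity, fun y hy => ?_⟩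
  have hy1 : 1 ≤ y := le_trans (by have : 0 ≤ s ^ 2 * R ^ 2 / (A - R ^ 2) := by positivity
                                   linarith) hy
  have hy0 : 0 < y := by linarith
  have hyt : s ^ 2 * R ^ 2 / (A - R ^ 2) < y ^ 2 := by nlinarith
  rw [mul_im_subordinationPart_I_mul hy0]
  set t := y ^ 2
  have ht : 0 < t := by positivity
  have ha := poissonMoment_pos (μ := μ) ht
  have h1 : poissonMoment μ t ≤ t⁻¹ := by
    have := norm_integral_le_of_norm_le_const (μ := μ)
      (Eventually.of_forall (abs_inv_sq_add_le ht))
    simp only [probReal_univ, mul_one] at this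
    exact (le_abs_self _).trans this
  have hsq := (memLp_id_of_ae_abs_le habs 2).integrable_sq
  have h2 : A / (s ^ 2 + t) ≤ 1 - t * poissonMoment μ t := by
    have e : 1 - t * poissonMoment μ t = ∫ x, (1 - t * (x ^ 2 + t)⁻¹) ∂μ := by
      rw [integral_sub (integrable_const _) ((integrable_inv_sq_add ht).const_mul _),
        integral_const_mul, poissonMoment]
      simp
    rw [e, hA, ← integral_div]
    refine integral_mono_ae (hsq.div_const _)
      ((integrable_const _).sub ((integrable_inv_sq_add ht).const_mul _)) ?_
    filter_upwards [h] with x hx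
    have e2 : 1 - t * (x ^ 2 + t)⁻¹ = x ^ 2 / (x ^ 2 + t) := by
      have : x ^ 2 + t ≠ 0 := by positivity
      field_simp
      ring
    rw [e2]
    have := hx.1
    have := hx.2
    gcongr
  have h3 : R ^ 2 < t * (A / (s ^ 2 + t)) := by
    rw [div_lt_iff₀ hAB] at hyt
    rw [← mul_div_assoc, lt_div_iff₀ (by positivity)]
    nlinarith
  have h4 : t ≤ (poissonMoment μ t)⁻¹ := by
    rw [le_inv_comm₀ ht ha]; exact h1
  have h5 : (poissonMoment μ t)⁻¹ - t
      = (poissonMoment μ t)⁻¹ * (1 - t * poissonMoment μ t) := by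
    field_simp
  rw [h5]
  refine h3.trans_le (mul_le_mul h4 h2 ?_ (by positivity))
  have : 0 ≤ A := sq_nonneg _
  positivity

/-- Otherwise, with `r = r₊`, one has `∫ x⁻² ≤ r⁻²`, so `∫ (x/r - r/x)² = ∫ x²/r² - 2 + r² ∫ x⁻² ≤
0` and `x = r` almost everywhere. -/
lemma innerRadius_lt_outerRadius {s : ℝ} (h : ∀ᵐ x ∂μ, x ∈ Icc 0 s)
    (hn : μ.support.Nontrivial) : innerRadius μ < outerRadius μ := by
  have hpos : ∀ᵐ x ∂μ, (0 : ℝ) ≤ x := h.mono fun x hx => hx.1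
  have hA := outerRadius_sq hpos
  have habs : ∀ᵐ x ∂μ, |x| ≤ s := h.mono fun x hx => by rw [abs_of_nonneg hx.1]; exact hx.2
  have hsq := (memLp_id_of_ae_abs_le habs 2).integrable_sq
  have hr : 0 < outerRadius μ := by
    refine outerRadius_nonneg.lt_of_ne fun h0 => ?_
    rw [← h0, eq_comm, zero_pow two_ne_zero,
      integral_eq_zero_iff_of_nonneg (fun x => sq_nonneg x) hsq] at hA
    exact support_nontrivial_of_not_ae_eq 0 (hA.mono fun x hx => by simpa using hx) hn
  rw [innerRadius_lt_iff hpos hr]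
  by_contra hL
  rw [not_lt] at hL
  set r := outerRadius μ
  have hLtop := ne_top_of_le_ne_top ENNReal.ofReal_ne_top hL
  have hne : ∀ᵐ x ∂μ, x ≠ 0 := by
    filter_upwards [ae_lt_top (by fun_prop) hLtop] with x hx h0
    simp [h0] at hx
  have hLeq : ∫⁻ x, (ENNReal.ofReal (x ^ 2))⁻¹ ∂μ = ∫⁻ x, ENNReal.ofReal ((x ^ 2)⁻¹) ∂μ := by
    refine lintegral_congr_ae (hne.mono fun x hx => ?_)
    exact (ENNReal.ofReal_inv_of_pos (by positivity)).symm
  rw [hLeq] at hL hLtop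
  have hi : Integrable (fun x : ℝ => (x ^ 2)⁻¹) μ :=
    (lintegral_ofReal_ne_top_iff_integrable (by fun_prop)
      (Eventually.of_forall fun x => by simp only [Pi.zero_apply]; positivity)).1 hLtop
  have hI : ∫ x, (x ^ 2)⁻¹ ∂μ ≤ (r ^ 2)⁻¹ := by
    rw [← ofReal_integral_eq_lintegral_ofReal hi
      (Eventually.of_forall fun x => by simp only [Pi.zero_apply]; positivity)] at hL
    exact (ENNReal.ofReal_le_ofReal_iff (by positivity)).1 hL
  have hexp : (fun x : ℝ => (x / r - r * x⁻¹) ^ 2)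
      =ᵐ[μ] fun x => (x ^ 2 / r ^ 2 - 2) + r ^ 2 * (x ^ 2)⁻¹ := by
    filter_upwards [hne] with x hx
    field_simp
    ring
  have hint1 : Integrable (fun x : ℝ => x ^ 2 / r ^ 2 - 2) μ :=
    (hsq.div_const _).sub (integrable_const _)
  have h0 : ∫ x, (x / r - r * x⁻¹) ^ 2 ∂μ ≤ 0 := by
    rw [integral_congr_ae hexp, integral_add hint1 (hi.const_mul _),
      integral_sub (hsq.div_const _) (integrable_const _), integral_div, ← hA, integral_const_mul]
    simp only [integral_const, probReal_univ, smul_eq_mul, one_mul]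
    have : r ^ 2 * ∫ x, (x ^ 2)⁻¹ ∂μ ≤ r ^ 2 * (r ^ 2)⁻¹ := by gcongr
    rw [mul_inv_cancel₀ (by positivity)] at this
    rw [div_self (by positivity)]
    linarith
  have h1 := le_antisymm h0 (integral_nonneg fun x => sq_nonneg _)
  rw [integral_eq_zero_iff_of_nonneg (fun x => sq_nonneg _)
    ((hint1.add (hi.const_mul _)).congr hexp.symm)] at h1
  refine support_nontrivial_of_not_ae_eq r ?_ hn
  filter_upwards [h1, hne, hpos] with x hx hx0 hxp
  have h2 : x / r - r * x⁻¹ = 0 := by simpa using hx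
  field_simp at h2
  have h3 : (x - r) * (x + r) = 0 := by linarith
  rcases mul_eq_zero.1 h3 with h4 | h4 <;> linarith

lemma support_nontrivial_of_innerRadius_lt {s : ℝ} (h : ∀ᵐ x ∂μ, x ∈ Icc 0 s)
    (hlt : innerRadius μ < outerRadius μ) : μ.support.Nontrivial := by
  by_contra hn
  rw [not_nontrivial_iff] at hn
  have hpos : ∀ᵐ x ∂μ, (0 : ℝ) ≤ x := h.mono fun x hx => hx.1
  obtain ⟨p, hp⟩ := Measure.nonempty_support (IsProbabilityMeasure.ne_zero μ)
  have hae : ∀ᵐ x ∂μ, x = p := mem_of_superset Measure.support_mem_ae fun x hx => hn hx hp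
  obtain ⟨x, hx, rfl⟩ := (h.and hae).exists
  have hx0 : 0 ≤ x := hx.1
  have h1 : outerRadius μ = x := by
    rw [outerRadius, restrict_Ici_zero hpos,
      integral_congr_ae (hae.mono fun y hy => by simp only [hy] : _ =ᵐ[μ] fun _ => x ^ 2)]
    simp [Real.sqrt_sq hx0]
  rw [h1] at hlt
  have hxp : 0 < x := innerRadius_nonneg.trans_lt hlt
  have hL : ∫⁻ y, (ENNReal.ofReal (y ^ 2))⁻¹ ∂μ = ∫⁻ _, (ENNReal.ofReal (x ^ 2))⁻¹ ∂μ :=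
    lintegral_congr_ae (hae.mono fun y hy => by simp only [hy])
  rw [innerRadius_lt_iff hpos hxp, hL, lintegral_const, measure_univ, mul_one,
    ENNReal.ofReal_inv_of_pos (by positivity)] at hlt
  exact lt_irrefl _ hlt

end Radii

/-! ### Existence of the subordination functions and of the free convolution -/

section Subordination

lemma IsSubordinationPair.snd_eq {μ₁ : Measure ℝ} {r : ℝ} {ω : (ℂ → ℂ) × (ℂ → ℂ)}
    (hω : IsSubordinationPair μ₁ (symmetrization (Measure.dirac r)) ω) {z : ℂ}
    (hz : z ∈ upperHalf) : ω.2 z = z - r ^ 2 / ω.1 z := by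
  have h1 : ω.1 z ∈ upperHalf := lt_of_lt_of_le hz (hω.im_le_fst z hz)
  have h2 := hω.add_eq z hz
  rw [hω.eq_F z hz, negRecipStieltjes_symmetrization_dirac r h1] at h2
  linear_combination h2

/-- Together with uniqueness of fixed points, this identifies the arbitrarily chosen
`subordinationPair` with the constructed solution. -/
lemma IsSubordinationPair.subordinationMap_fst {μ₁ : Measure ℝ} {r : ℝ}
    {ω : (ℂ → ℂ) × (ℂ → ℂ)}
    (hω : IsSubordinationPair μ₁ (symmetrization (Measure.dirac r)) ω) {z : ℂ}
    (hz : z ∈ upperHalf) :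
    subordinationMap (subordinationPart μ₁) r z (ω.1 z) = ω.1 z := by
  have h2 := hω.add_eq z hz
  rw [subordinationMap, ← hω.snd_eq hz, subordinationPart, ← h2]
  ring

/-- For a compactly supported centred measure, the fixed points of the subordination map form a
pair of subordination functions. -/
lemma isSubordinationPair_fixedPoint {μ₁ : Measure ℝ} {s : ℝ}
    (H : IsPickMap (subordinationPart μ₁) s) (r : ℝ) :
    IsSubordinationPair μ₁ (symmetrization (Measure.dirac r))
      (subordinationFixedPoint (subordinationPart μ₁) r,
        fun z => z - r ^ 2 / subordinationFixedPoint (subordinationPart μ₁) r z) := by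
  set ω := subordinationFixedPoint (subordinationPart μ₁) r
  have hmem : ∀ z ∈ upperHalf, ω z ∈ upperHalf := fun z hz => H.subordinationFixedPoint_mem r hz
  have hfix : ∀ z ∈ upperHalf, z + subordinationPart μ₁ (z - r ^ 2 / ω z) = ω z := fun z hz =>
    H.subordinationMap_fixedPoint r hz
  have hadd : ∀ z ∈ upperHalf, ω z + (z - r ^ 2 / ω z) - z
      = negRecipStieltjes μ₁ (z - r ^ 2 / ω z) := by
    intro z hz
    have := hfix z hz
    rw [subordinationPart] at this
    linear_combination -this
  have hI : ∀ η : ℝ, 0 < η → (Complex.I * (η : ℂ)) ≠ 0 := fun η hη =>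
    ne_zero_of_mem_upperHalf (I_mul_mem_upperHalf hη)
  have hn : ∀ η : ℝ, 0 < η → ‖Complex.I * (η : ℂ)‖ = η := fun η hη => by simp [abs_of_pos hη]
  constructor
  · exact H.differentiableOn_subordinationFixedPoint r
  · exact differentiableOn_id.sub ((differentiableOn_const _).div
      (H.differentiableOn_subordinationFixedPoint r) fun z hz => ne_zero_of_mem_upperHalf (hmem z hz))
  · exact fun z hz => H.im_le_im_subordinationFixedPoint r hz
  · exact fun z hz => im_le_im_sub_sq_div r z (hmem z hz)
  · have h1 : Tendsto (fun η : ℝ => s * (η⁻¹ * η⁻¹)) atTop (𝓝 0) := by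
      simpa using (tendsto_inv_atTop_zero.mul tendsto_inv_atTop_zero).const_mul s
    refine tendsto_iff_norm_sub_tendsto_zero.2 (squeeze_zero' (Eventually.of_forall fun _ =>
      norm_nonneg _) ?_ h1)
    filter_upwards [eventually_gt_atTop 0] with η hη
    have hz := I_mul_mem_upperHalf hη
    have h2 := H.norm_subordinationMap_sub_le r hη (z := Complex.I * η) (by simp) (hmem _ hz)
    rw [H.subordinationMap_fixedPoint r hz] at h2
    rw [div_sub_one (hI η hη), norm_div, hn η hη, div_le_iff₀ hη]
    refine h2.trans_eq ?_
    field_simp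
  · have h1 : Tendsto (fun η : ℝ => r ^ 2 * (η⁻¹ * η⁻¹)) atTop (𝓝 0) := by
      simpa using (tendsto_inv_atTop_zero.mul tendsto_inv_atTop_zero).const_mul (r ^ 2)
    refine tendsto_iff_norm_sub_tendsto_zero.2 (squeeze_zero' (Eventually.of_forall fun _ =>
      norm_nonneg _) ?_ h1)
    filter_upwards [eventually_gt_atTop 0] with η hη
    have hz := I_mul_mem_upperHalf hη
    have h2 : η ≤ ‖ω (Complex.I * η)‖ := by
      have := H.im_le_im_subordinationFixedPoint r hz
      simp only [Complex.mul_im, Complex.I_re, Complex.I_im, Complex.ofReal_re,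
        Complex.ofReal_im] at this
      refine le_trans ?_ ((this.trans (le_abs_self _)).trans (Complex.abs_im_le_norm _))
      simp
    rw [div_sub_one (hI η hη), norm_div, hn η hη, sub_sub_cancel_left, norm_neg, norm_div,
      norm_pow, Complex.norm_real, Real.norm_eq_abs, sq_abs, div_div, div_eq_mul_inv, mul_inv]
    gcongr
  · intro z hz
    simp only
    rw [negRecipStieltjes_symmetrization_dirac r (hmem z hz), ← hadd z hz]
    ring
  · exact hadd

lemma isSubordinationPair_subordinationPair {μ₁ : Measure ℝ} {s : ℝ}
    (H : IsPickMap (subordinationPart μ₁) s) (r : ℝ) :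
    IsSubordinationPair μ₁ (symmetrization (Measure.dirac r))
      (subordinationPair μ₁ (symmetrization (Measure.dirac r))) :=
  Classical.epsilon_spec (p := IsSubordinationPair μ₁ (symmetrization (Measure.dirac r)))
    ⟨_, isSubordinationPair_fixedPoint H r⟩

/-- Whenever subordination functions exist, so does the free additive convolution. -/
lemma isFreeAddConv_freeAddConv {μ₁ μ₂ : Measure ℝ} [IsProbabilityMeasure μ₁]
    (h : IsSubordinationPair μ₁ μ₂ (subordinationPair μ₁ μ₂)) :
    IsFreeAddConv μ₁ μ₂ (freeAddConv μ₁ μ₂) := by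
  set ω := subordinationPair μ₁ μ₂
  have hmem : ∀ z ∈ upperHalf, ω.2 z ∈ upperHalf := fun z hz =>
    lt_of_lt_of_le hz (h.im_le_snd z hz)
  obtain ⟨μ, hμ, hst⟩ := exists_probabilityMeasure_stieltjes_eq
    (m := fun z => stieltjes μ₁ (ω.2 z)) (differentiableOn_stieltjes.comp h.analytic_snd hmem)
    (fun z hz => (im_stieltjes_pos (hmem z hz)).le)
    (fun z hz => (norm_stieltjes_le (hmem z hz)).trans (inv_anti₀ hz (h.im_le_snd z hz))) (by
      -- By the subordination equation `iη · m(iη) = -(ω₁/(iη) + ω₂/(iη) - 1)⁻¹`, which tends to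
      -- `-1`.
      have h1 := ((h.tendsto_fst.add h.tendsto_snd).sub_const 1).inv₀ (by norm_num)
      have h2 : Tendsto (fun η : ℝ => -(ω.1 (Complex.I * η) / (Complex.I * η)
          + ω.2 (Complex.I * η) / (Complex.I * η) - 1)⁻¹) atTop (𝓝 (-1)) := by
        convert! h1.neg using 2
        norm_num
      refine h2.congr' ?_
      filter_upwards [eventually_gt_atTop 0] with η hη
      have hz := I_mul_mem_upperHalf hη
      have h0 := ne_zero_of_mem_upperHalf hz
      have h3 := h.add_eq _ hz
      have h4 : stieltjes μ₁ (ω.2 (Complex.I * η))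
          = -(ω.1 (Complex.I * η) + ω.2 (Complex.I * η) - Complex.I * η)⁻¹ := by
        rw [h3, negRecipStieltjes, inv_neg, inv_inv, neg_neg]
      rw [h4, ← add_div, div_sub_one h0, inv_div]
      ring)
  refine Classical.epsilon_spec (p := IsFreeAddConv μ₁ μ₂) ⟨μ, hμ, fun z hz => ?_⟩
  rw [negRecipStieltjes, negRecipStieltjes, hst z hz]

lemma IsFreeAddConv.stieltjes_eq {μ₁ μ₂ μ : Measure ℝ} (h : IsFreeAddConv μ₁ μ₂ μ) {z : ℂ}
    (hz : z ∈ upperHalf) : stieltjes μ z = stieltjes μ₁ ((subordinationPair μ₁ μ₂).2 z) := by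
  have := h.eq_F z hz
  rw [negRecipStieltjes, negRecipStieltjes] at this
  exact inv_injective (neg_injective this)

/-- The subordination functions are purely imaginary on the imaginary axis. -/
lemma subordinationFixedPoint_I_mul {h : ℂ → ℂ} {s : ℝ} (H : IsPickMap h s)
    (hsymm : ∀ w ∈ upperHalf, h (-(starRingEnd ℂ) w) = -(starRingEnd ℂ) (h w)) (r : ℝ) {η : ℝ}
    (hη : 0 < η) :
    subordinationFixedPoint h r (Complex.I * η)
      = Complex.I * ((subordinationFixedPoint h r (Complex.I * η)).im : ℂ) := by
  have hz := I_mul_mem_upperHalf hη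
  set z := Complex.I * (η : ℂ)
  set ω := subordinationFixedPoint h r z
  have hω : ω ∈ upperHalf := H.subordinationFixedPoint_mem r hz
  have hfix : subordinationMap h r z ω = ω := H.subordinationMap_fixedPoint r hz
  have hzc : -(starRingEnd ℂ) z = z := by simp [z]
  -- Since `z` is fixed by the reflection `w ↦ -w̄`, the reflected fixed point is again one, so by
  -- uniqueness it is `ω`.
  have h1 : subordinationMap h r z (-(starRingEnd ℂ) ω) = -(starRingEnd ℂ) ω := by
    have e : z - (r : ℂ) ^ 2 / -(starRingEnd ℂ) ω
        = -(starRingEnd ℂ) (z - (r : ℂ) ^ 2 / ω) := by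
      rw [map_sub, map_div₀, map_pow, Complex.conj_ofReal, neg_sub', hzc, div_neg]
    rw [subordinationMap, e, hsymm _ (sub_sq_div_mem r hz hω)]
    conv_rhs => rw [← hfix, subordinationMap, map_add, neg_add, hzc]
  have h2 := H.fixedPoint_unique r hz (neg_conj_mem_upperHalf hω) hω h1 hfix
  have h3 := congrArg Complex.re h2
  simp only [Complex.neg_re, Complex.conj_re] at h3
  apply Complex.ext
  · simp; linarith
  · simp

end Subordination

/-! ### Continuation of the fixed point across `0` -/

section Boundary

lemma extendToBoundary_of_tendsto {f : ℂ → ℂ} {z w : ℂ} (hz : 0 ≤ z.im)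
    (h : Tendsto f (𝓝[upperHalf] z) (𝓝 w)) : extendToBoundary f z = w := by
  refine extendFrom_eq ?_ h
  have : upperHalf = {z : ℂ | 0 < z.im} := rfl
  rw [this, Complex.closure_setOfPred_lt_im]
  exact hz

lemma extendToBoundary_of_mem {f : ℂ → ℂ} (hf : ContinuousOn f upperHalf) {z : ℂ}
    (hz : z ∈ upperHalf) : extendToBoundary f z = f z :=
  extendToBoundary_of_tendsto (le_of_lt hz) (hf z hz)

lemma tendsto_nhdsWithin_upperHalf_zero {f g : ℂ → ℂ} {δ : ℝ} (hδ : 0 < δ)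
    (hg : ContinuousOn g (Metric.ball 0 δ))
    (h : ∀ z ∈ Metric.ball 0 δ, z ∈ upperHalf → f z = g z) :
    Tendsto f (𝓝[upperHalf] 0) (𝓝 (g 0)) := by
  have hb := Metric.ball_mem_nhds (0 : ℂ) hδ
  have h1 : Tendsto g (𝓝[upperHalf] 0) (𝓝 (g 0)) :=
    (hg.continuousAt hb).tendsto.mono_left nhdsWithin_le_nhds
  refine h1.congr' ?_
  filter_upwards [self_mem_nhdsWithin, nhdsWithin_le_nhds hb] with z hz hzb
  exact (h z hzb hz).symm

lemma isInvertible_of_apply_one_ne_zero (L : ℂ →L[ℂ] ℂ) (h : L 1 ≠ 0) : L.IsInvertible := by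
  refine ⟨ContinuousLinearEquiv.unitsEquivAut ℂ (Units.mk0 _ h), ?_⟩
  ext
  simp

/-- A nondegenerate purely imaginary solution of the subordination equation at `0` continues to a
continuous solution near `0`, which agrees with the fixed point on the upper half-plane. -/
lemma IsPickMap.exists_continuousOn_fixedPoint {h : ℂ → ℂ} {s : ℝ} (H : IsPickMap h s) (r : ℝ)
    {ω₀ d : ℂ} (hω₀ : ω₀ ∈ upperHalf) (hw₀ : -((r : ℂ) ^ 2 / ω₀) ∈ upperHalf)
    (heq : h (-((r : ℂ) ^ 2 / ω₀)) = ω₀) (hd : HasDerivAt h d (-((r : ℂ) ^ 2 / ω₀)))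
    (hne : 1 - d * ((r : ℂ) ^ 2 / ω₀ ^ 2) ≠ 0) :
    ∃ (φ : ℂ → ℂ) (δ : ℝ), 0 < δ ∧ ContinuousOn φ (Metric.ball 0 δ) ∧ φ 0 = ω₀ ∧
      (∀ z ∈ Metric.ball (0 : ℂ) δ, φ z ∈ upperHalf ∧ z - (r : ℂ) ^ 2 / φ z ∈ upperHalf) ∧
      ∀ z ∈ Metric.ball (0 : ℂ) δ, z ∈ upperHalf → subordinationFixedPoint h r z = φ z := by
  have h0 := ne_zero_of_mem_upperHalf hω₀
  -- Zeros of `f` are solutions of the fixed-point equation, and `f` stays analytic for `z` near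
  -- `0`, since `z - r²/ω` is near `-r²/ω₀` in the open half-plane. Its `ω`-derivative at the given
  -- solution is the quantity assumed nonzero.
  set f : ℂ × ℂ → ℂ := fun p => p.2 - p.1 - h (p.1 - (r : ℂ) ^ 2 / p.2) with hf
  have hcd : ContDiffAt ℂ 1 f (0, ω₀) := by
    have h1 : ContDiffAt ℂ 1 h (((0 : ℂ), ω₀).1 - (r : ℂ) ^ 2 / ((0 : ℂ), ω₀).2) := by
      simp only [zero_sub]
      exact (H.differentiableOn.analyticAt (isOpen_upperHalf.mem_nhds hw₀)).contDiffAt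
    refine (contDiffAt_snd.sub contDiffAt_fst).sub (ContDiffAt.comp (0, ω₀) h1 ?_)
    exact contDiffAt_fst.sub (contDiffAt_const.div contDiffAt_snd h0)
  have hinv : (fderiv ℂ f (0, ω₀) ∘L .inr ℂ ℂ ℂ).IsInvertible := by
    apply isInvertible_of_apply_one_ne_zero
    have h1 : HasDerivAt (fun ω => f (0, ω)) ((fderiv ℂ f (0, ω₀)) (0, 1)) ω₀ := by
      have h2 : HasDerivAt (fun ω : ℂ => ((0 : ℂ), ω)) (0, 1) ω₀ :=
        (hasDerivAt_const _ _).prodMk (hasDerivAt_id _)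
      exact (hcd.differentiableAt one_ne_zero).hasFDerivAt.comp_hasDerivAt ω₀ h2
    have h2 : HasDerivAt (fun ω => f (0, ω)) (1 - d * ((r : ℂ) ^ 2 / ω₀ ^ 2)) ω₀ := by
      have h3 : HasDerivAt (fun ω : ℂ => -((r : ℂ) ^ 2 / ω)) ((r : ℂ) ^ 2 / ω₀ ^ 2) ω₀ := by
        have := (((hasDerivAt_const ω₀ ((r : ℂ) ^ 2)).div (hasDerivAt_id ω₀) h0)).neg
        convert! this using 1
        simp
        ring
      have h4 := (hasDerivAt_id ω₀).sub (HasDerivAt.comp ω₀ hd h3)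
      convert! h4 using 1
      ext ω
      simp [hf]
    simp only [ContinuousLinearMap.comp_apply, ContinuousLinearMap.inr_apply]
    rwa [h1.unique h2]
  set φ := hcd.implicitFunction one_ne_zero hinv
  have hφ0 : φ 0 = ω₀ := hcd.implicitFunction_apply_self one_ne_zero hinv
  have hφc : ContDiffAt ℂ 1 φ 0 := hcd.contDiffAt_implicitFunction one_ne_zero hinv
  have hf0 : f (0, ω₀) = 0 := by simp [hf, heq]
  have e1 : ∀ᶠ z in 𝓝 (0 : ℂ), f (z, φ z) = 0 := by
    have := hcd.eventually_apply_implicitFunction one_ne_zero hinv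
    rwa [hf0] at this
  have e2 : ∀ᶠ z in 𝓝 (0 : ℂ), ContinuousAt φ z :=
    (hφc.eventually (by simp)).mono fun z hz => hz.continuousAt
  have e3 : ∀ᶠ z in 𝓝 (0 : ℂ), φ z ∈ upperHalf :=
    hφc.continuousAt.eventually (by rw [hφ0]; exact isOpen_upperHalf.mem_nhds hω₀)
  have e4 : ∀ᶠ z in 𝓝 (0 : ℂ), z - (r : ℂ) ^ 2 / φ z ∈ upperHalf := by
    have hc : ContinuousAt (fun z => z - (r : ℂ) ^ 2 / φ z) 0 :=
      continuousAt_id.sub (continuousAt_const.div hφc.continuousAt (by rwa [hφ0]))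
    refine hc.eventually (isOpen_upperHalf.mem_nhds ?_)
    simpa only [hφ0, zero_sub] using hw₀
  obtain ⟨δ, hδ, hball⟩ := Metric.eventually_nhds_iff_ball.1 (e1.and (e2.and (e3.and e4)))
  refine ⟨φ, δ, hδ, fun z hz => (hball z hz).2.1.continuousWithinAt, hφ0,
    fun z hz => (hball z hz).2.2, fun z hz hzu => ?_⟩
  obtain ⟨h1, -, h3, -⟩ := hball z hz
  refine H.fixedPoint_unique r hzu (H.subordinationFixedPoint_mem r hzu) h3
    (H.subordinationMap_fixedPoint r hzu) ?_
  simp only [hf] at h1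
  rw [subordinationMap]
  linear_combination -h1

end Boundary

/-! ### Solvability and nondegeneracy at `0` -/

section Nondegenerate

variable {μ : Measure ℝ} [IsProbabilityMeasure μ]

/-- The gap is the variance of `(x² + t)⁻¹`. If it vanished, `x²` would be almost everywhere
constant, hence so would `x`, being nonnegative. -/
lemma sq_poissonMoment_lt (hpos : ∀ᵐ x ∂μ, (0 : ℝ) ≤ x) (hn : μ.support.Nontrivial) {t : ℝ}
    (ht : 0 < t) : poissonMoment μ t ^ 2 < ∫ x, ((x ^ 2 + t)⁻¹) ^ 2 ∂μ := by
  by_contra hle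
  rw [not_lt] at hle
  set a := poissonMoment μ t with ha
  have hsq := (memLp_inv_sq_add (μ := μ) ht 2).integrable_sq
  have hi := integrable_inv_sq_add (μ := μ) ht
  have hexp : ∀ x : ℝ, ((x ^ 2 + t)⁻¹ - a) ^ 2
      = (((x ^ 2 + t)⁻¹) ^ 2 - 2 * a * (x ^ 2 + t)⁻¹) + a ^ 2 := fun x => by ring
  have hint : Integrable (fun x : ℝ => ((x ^ 2 + t)⁻¹) ^ 2 - 2 * a * (x ^ 2 + t)⁻¹) μ :=
    hsq.sub (hi.const_mul _)
  have h0 : ∫ x, ((x ^ 2 + t)⁻¹ - a) ^ 2 ∂μ ≤ 0 := by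
    simp_rw [hexp]
    rw [integral_add hint (integrable_const _), integral_sub hsq (hi.const_mul _),
      integral_const_mul]
    change _ - 2 * a * a + _ ≤ 0
    simp only [integral_const, probReal_univ, smul_eq_mul, one_mul]
    linarith
  have h1 := le_antisymm h0 (integral_nonneg fun x => sq_nonneg _)
  rw [integral_eq_zero_iff_of_nonneg (fun x => sq_nonneg _)
    ((hint.add (integrable_const (a ^ 2))).congr
      (Eventually.of_forall fun x => (hexp x).symm))] at h1
  refine support_nontrivial_of_not_ae_eq (√(a⁻¹ - t)) ?_ hn
  filter_upwards [h1, hpos] with x hx hx0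
  have h2 : (x ^ 2 + t)⁻¹ = a := by
    have : (x ^ 2 + t)⁻¹ - a = 0 := by simpa using hx
    linarith
  rw [← h2, inv_inv, add_sub_cancel_right, Real.sqrt_sq hx0]

lemma integral_resolvent_sq_symmetrization {y : ℝ} (hy : 0 < y) :
    ∫ x : ℝ, (((x : ℂ) - Complex.I * y)⁻¹) ^ 2 ∂(symmetrization μ)
      = ((poissonMoment μ (y ^ 2) - 2 * y ^ 2 * ∫ x, ((x ^ 2 + y ^ 2)⁻¹) ^ 2 ∂μ : ℝ) : ℂ) := by
  have hw := I_mul_mem_upperHalf hy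
  have ht := pow_pos hy 2
  have hi : ∀ ε : ℝ, Integrable (fun x : ℝ => ((((ε * x : ℝ) : ℂ) - Complex.I * y)⁻¹) ^ 2) μ := by
    intro ε
    refine Integrable.of_bound (C := ((Complex.I * (y : ℂ)).im⁻¹) ^ 2)
      (((continuous_resolvent hw).comp (by fun_prop : Continuous fun x : ℝ => ε * x)).pow
        2).aestronglyMeasurable (Eventually.of_forall fun x => ?_)
    rw [norm_pow]
    gcongr
    exact norm_resolvent_le hw (ε * x)
  rw [integral_symmetrization (f := fun x : ℝ => (((x : ℂ) - Complex.I * y)⁻¹) ^ 2)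
    ((continuous_resolvent hw).pow 2) (by simpa using hi 1)
    (by simpa using hi (-1)), Complex.real_smul, poissonMoment, ← integral_const_mul,
    ← integral_const_mul, ← integral_sub (integrable_inv_sq_add ht)
      ((memLp_inv_sq_add ht 2).integrable_sq.const_mul _), ← integral_complex_ofReal]
  congr 1
  ext x
  have h1 := ofReal_sub_ne_zero hw x
  have h2 := ofReal_sub_ne_zero hw (-x)
  have h3 : ((x ^ 2 + y ^ 2 : ℝ) : ℂ) ≠ 0 := by
    exact_mod_cast (by positivity : (x ^ 2 + y ^ 2 : ℝ) ≠ 0)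
  have h4 : ((x : ℂ) - Complex.I * y) * (((-x : ℝ) : ℂ) - Complex.I * y)
      = -((x ^ 2 + y ^ 2 : ℝ) : ℂ) := by
    push_cast
    linear_combination (y : ℂ) ^ 2 * Complex.I_sq
  have h5 : ((((x : ℂ) - Complex.I * y)⁻¹) ^ 2 + ((((-x : ℝ) : ℂ) - Complex.I * y)⁻¹) ^ 2)
      = ((((-x : ℝ) : ℂ) - Complex.I * y) ^ 2 + ((x : ℂ) - Complex.I * y) ^ 2)
        / (((x : ℂ) - Complex.I * y) * (((-x : ℝ) : ℂ) - Complex.I * y)) ^ 2 := by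
    field_simp
  rw [h5, h4]
  push_cast at h3 ⊢
  field_simp
  linear_combination 2 * (y : ℂ) ^ 2 * Complex.I_sq

/-- Nondegeneracy of the subordination equation on the imaginary axis. -/
lemma exists_hasDerivAt_subordinationPart (hpos : ∀ᵐ x ∂μ, (0 : ℝ) ≤ x)
    (hn : μ.support.Nontrivial) {y : ℝ} (hy : 0 < y) :
    ∃ d : ℝ, HasDerivAt (subordinationPart (symmetrization μ)) (d : ℂ) (Complex.I * y) ∧
      0 < y * (subordinationPart (symmetrization μ) (Complex.I * y)).im + d * y ^ 2 := by
  have hw := I_mul_mem_upperHalf hy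
  have ht := pow_pos hy 2
  have ha := poissonMoment_pos (μ := μ) ht
  have hvar := sq_poissonMoment_lt hpos hn ht
  set a := poissonMoment μ (y ^ 2)
  set b := ∫ x, ((x ^ 2 + y ^ 2)⁻¹) ^ 2 ∂μ
  -- `d` is `m'/m² - 1` with `m = i y a` and `m' = a - 2 y² b`. The quantity to be shown positive
  -- then reduces to `2 y² (b - a²) / a²`.
  refine ⟨-(a - 2 * y ^ 2 * b) / (y * a) ^ 2 - 1, ?_, ?_⟩
  · have h1 := hasDerivAt_stieltjes (μ := symmetrization μ) hw
    rw [integral_resolvent_sq_symmetrization hy] at h1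
    have h2 := ((h1.inv (stieltjes_ne_zero hw)).neg).sub (hasDerivAt_id _)
    convert! h2 using 1
    rw [stieltjes_symmetrization_I_mul hy, mul_pow Complex.I, Complex.I_sq]
    push_cast
    ring
  · rw [mul_im_subordinationPart_I_mul hy]
    change 0 < a⁻¹ - y ^ 2 + _
    have e : a⁻¹ - y ^ 2 + (-(a - 2 * y ^ 2 * b) / (y * a) ^ 2 - 1) * y ^ 2
        = 2 * y ^ 2 * (b - a ^ 2) / a ^ 2 := by
      field_simp
      ring
    rw [e]
    have : 0 < b - a ^ 2 := by linarith
    positivity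

lemma exists_mul_im_subordinationPart_eq {r a b : ℝ} (ha : 0 < a) (hb : 0 < b)
    (h1 : a * (subordinationPart (symmetrization μ) (Complex.I * a)).im < r ^ 2)
    (h2 : r ^ 2 < b * (subordinationPart (symmetrization μ) (Complex.I * b)).im) :
    ∃ y : ℝ, 0 < y ∧ y * (subordinationPart (symmetrization μ) (Complex.I * y)).im = r ^ 2 := by
  have hc : ContinuousOn
      (fun y : ℝ => y * (subordinationPart (symmetrization μ) (Complex.I * y)).im) (uIcc a b) := by
    refine continuousOn_id.mul (Complex.continuous_im.comp_continuousOn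
      (differentiableOn_subordinationPart.continuousOn.comp (by fun_prop) fun y hy => ?_))
    exact I_mul_mem_upperHalf ((lt_min ha hb).trans_le hy.1)
  obtain ⟨y, hy, hyr⟩ := intermediate_value_uIcc hc
    (show r ^ 2 ∈ uIcc _ _ from mem_uIcc_of_le h1.le h2.le)
  exact ⟨y, (lt_min ha hb).trans_le hy.1, hyr⟩

end Nondegenerate

/-- A priori bounds for the subordination equation on the imaginary axis. -/
lemma subordination_bounds {r η y y₁ G a b lo hi N A : ℝ} (ha : 0 < a) (hlo : 0 < lo) (hA : 0 ≤ A)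
    (hr : lo ≤ r) (hr' : r ≤ hi) (hη : 0 ≤ η) (hηN : η ≤ N) (hy₁ : 0 < y₁)
    (hy : y = η + r ^ 2 / y₁) (hG : y * (y₁ - η) = G) (hGA : G ≤ A)
    (hGa : y ≤ a → G < r ^ 2) (hGb : b ≤ y → r ^ 2 < G) :
    min a lo ≤ y ∧ y ≤ max b (N + hi) ∧ lo ^ 2 / max b (N + hi) ≤ y₁ ∧
      y₁ ≤ N + A / min a lo := by
  have hr0 : 0 < r := hlo.trans_le hr
  have hq : 0 < r ^ 2 / y₁ := by positivity
  have hyη : η < y := by linarith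
  have hy0 : 0 < y := by linarith
  have hprod : (y - η) * y₁ = r ^ 2 := by rw [hy]; field_simp; ring
  have h1 : min a lo ≤ y := by
    by_contra hlt
    rw [not_le, lt_min_iff] at hlt
    -- Comparing `G = y (y₁ - η)` with `r² = (y - η) y₁`, the inequality `G < r²` says `η y₁ < η y`,
    -- so `y₁ < y` and `r² ≤ y y₁ < y² < lo²`, a contradiction.
    have h2 := hGa hlt.1.le
    have h3 : y₁ < y := by
      by_contra hc
      have := mul_nonneg hη (sub_nonneg.2 (not_lt.1 hc))
      linarith
    have h4 : (y - η) * y₁ ≤ y * y₁ := by gcongr; linarith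
    have h5 : y * y₁ < y * y := by gcongr
    have h6 : y * y < lo * lo := by gcongr <;> exact hlt.2
    have h7 : lo * lo ≤ r * r := by gcongr
    linarith
  have h2 : y ≤ max b (N + hi) := by
    by_contra hlt
    rw [not_le, max_lt_iff] at hlt
    -- Here `G > r²` gives `y < y₁`, so `r² = (y - η) y₁ > (y - η)² ≥ hi²`, as `y > N + hi`.
    have h3 := hGb hlt.1.le
    have h4 : y < y₁ := by
      by_contra hc
      have := mul_nonneg hη (sub_nonneg.2 (not_lt.1 hc))
      linarith
    have h5 : 0 < y - η := by linarith
    have h6 : (y - η) * (y - η) < (y - η) * y₁ := by gcongr; linarith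
    have h7 : hi * hi ≤ (y - η) * (y - η) := by gcongr <;> linarith
    have h8 : r * r ≤ hi * hi := mul_self_le_mul_self hr0.le hr'
    linarith
  have hmin : 0 < min a lo := lt_min ha hlo
  refine ⟨h1, h2, ?_, ?_⟩
  · rw [div_le_iff₀ (hy0.trans_le h2)]
    nlinarith
  · have h3 : y₁ - η ≤ A / min a lo := by
      rcases le_or_gt (y₁ - η) 0 with h0 | h0
      · exact h0.trans (div_nonneg hA hmin.le)
      · rw [le_div_iff₀ hmin]
        nlinarith
    linarith

/-! ### Boundary behaviour and the main theorem -/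

section Main

variable {μ : Measure ℝ} [IsProbabilityMeasure μ]

/-- Boundary behaviour at `0` of the subordination functions and of the Stieltjes transform of the
free convolution, and their values on the imaginary axis. -/
lemma freeAddConv_boundary_behaviour {s : ℝ} (h : ∀ᵐ x ∂μ, x ∈ Icc 0 s)
    (hn : μ.support.Nontrivial) {r a b : ℝ} (hr : 0 < r) (ha : 0 < a) (hb : 0 < b)
    (h1 : a * (subordinationPart (symmetrization μ) (Complex.I * a)).im < r ^ 2)
    (h2 : r ^ 2 < b * (subordinationPart (symmetrization μ) (Complex.I * b)).im)
    {ω₁ ω₂ m : ℂ → ℂ} {ν : Measure ℝ}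
    (hω₁ : ω₁ = (subordinationPair (symmetrization μ) (symmetrization (Measure.dirac r))).1)
    (hω₂ : ω₂ = (subordinationPair (symmetrization μ) (symmetrization (Measure.dirac r))).2)
    (hν : ν = freeAddConv (symmetrization μ) (symmetrization (Measure.dirac r)))
    (hm : m = stieltjes ν) :
    (HasBoundaryValue ω₁ 0 ∧ HasBoundaryValue ω₂ 0 ∧ HasBoundaryValue m 0) ∧
    (∀ η : ℝ, 0 ≤ η → ∃ y y₁ : ℝ, 0 < y₁ ∧ y = η + r ^ 2 / y₁ ∧
      y * (y₁ - η) = y * (subordinationPart (symmetrization μ) (Complex.I * y)).im ∧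
      extendToBoundary ω₁ (Complex.I * η) = Complex.I * y₁ ∧
      extendToBoundary ω₂ (Complex.I * η) = Complex.I * y ∧
      extendToBoundary m (Complex.I * η) = Complex.I * (((y + y₁ - η)⁻¹ : ℝ) : ℂ)) ∧
    HasDensityAt ν 0 ((extendToBoundary m 0).im / Real.pi) := by
  have hpos : ∀ᵐ x ∂μ, (0 : ℝ) ≤ x := h.mono fun x hx => hx.1
  have habs : ∀ᵐ x ∂μ, |x| ≤ s := h.mono fun x hx => by rw [abs_of_nonneg hx.1]; exact hx.2
  have H := isPickMap_subordinationPart_symmetrization habs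
  have hpair := isSubordinationPair_subordinationPair H r
  have hfree := isFreeAddConv_freeAddConv hpair
  set g := subordinationPart (symmetrization μ) with hg
  have hω₁z : ∀ z ∈ upperHalf, ω₁ z = subordinationFixedPoint g r z := by
    intro z hz
    have hmem : ω₁ z ∈ upperHalf := by
      rw [hω₁]; exact lt_of_lt_of_le hz (hpair.im_le_fst z hz)
    refine H.fixedPoint_unique r hz hmem (H.subordinationFixedPoint_mem r hz) ?_
      (H.subordinationMap_fixedPoint r hz)
    rw [hω₁]
    exact hpair.subordinationMap_fst hz
  have hω₂z : ∀ z ∈ upperHalf, ω₂ z = z - r ^ 2 / subordinationFixedPoint g r z := by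
    intro z hz
    rw [← hω₁z z hz, hω₁, hω₂]
    exact hpair.snd_eq hz
  have hmz : ∀ z ∈ upperHalf, m z = stieltjes (symmetrization μ) (ω₂ z) := by
    intro z hz
    rw [hm, hν, hω₂]
    exact hfree.stieltjes_eq hz
  have : IsProbabilityMeasure ν := hν ▸ hfree.isProbabilityMeasure
  -- the value of the Stieltjes transform at a purely imaginary solution
  have hval : ∀ η y y₁ : ℝ, 0 < y → g (Complex.I * y) = Complex.I * ((y₁ - η : ℝ) : ℂ) →
      stieltjes (symmetrization μ) (Complex.I * y) = Complex.I * (((y + y₁ - η)⁻¹ : ℝ) : ℂ) := by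
    intro η y y₁ hy hgy
    have h3 : negRecipStieltjes (symmetrization μ) (Complex.I * y)
        = Complex.I * ((y + y₁ - η : ℝ) : ℂ) := by
      have : negRecipStieltjes (symmetrization μ) (Complex.I * y)
          = g (Complex.I * y) + Complex.I * y := by rw [hg, subordinationPart]; ring
      rw [this, hgy]
      push_cast
      ring
    have h4 : stieltjes (symmetrization μ) (Complex.I * y)
        = -(negRecipStieltjes (symmetrization μ) (Complex.I * y))⁻¹ := by
      rw [negRecipStieltjes, inv_neg, inv_inv, neg_neg]
    rw [h4, h3, mul_inv, Complex.inv_I]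
    push_cast
    ring
  -- the solution at `0`
  obtain ⟨y₀, hy₀, hgy₀⟩ := exists_mul_im_subordinationPart_eq ha hb h1 h2
  rw [← hg] at hgy₀
  have hy₀C : (y₀ : ℂ) ≠ 0 := by exact_mod_cast hy₀.ne'
  have hrC : (r : ℂ) ≠ 0 := by exact_mod_cast hr.ne'
  have hw₀ : -((r : ℂ) ^ 2 / (Complex.I * ((r ^ 2 / y₀ : ℝ) : ℂ))) = Complex.I * y₀ := by
    push_cast
    have := Complex.I_ne_zero
    field_simp
    linear_combination -Complex.I_sq
  have hgI : ∀ y : ℝ, 0 < y → g (Complex.I * y) = Complex.I * ((g (Complex.I * y)).im : ℂ) := by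
    intro y hy
    rw [hg, subordinationPart_I_mul hy]
    simp
  have hg₀ : g (Complex.I * y₀) = Complex.I * ((r ^ 2 / y₀ : ℝ) : ℂ) := by
    rw [hgI y₀ hy₀, ← hgy₀, mul_div_cancel_left₀ _ hy₀.ne']
  obtain ⟨d, hd, hdpos⟩ := exists_hasDerivAt_subordinationPart hpos hn hy₀
  rw [← hg, hgy₀] at hdpos
  obtain ⟨φ, δ, hδ, hφc, hφ0, hφmem, hφeq⟩ := H.exists_continuousOn_fixedPoint r
    (ω₀ := Complex.I * ((r ^ 2 / y₀ : ℝ) : ℂ)) (d := d) (I_mul_mem_upperHalf (by positivity))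
    (by rw [hw₀]; exact I_mul_mem_upperHalf hy₀) (by rw [hw₀]; exact hg₀) (by rw [hw₀]; exact hd)
    (by
      -- With `ω₀ = i r²/y₀` and `G(y₀) = r²`, the nondegeneracy condition is exactly the positivity
      -- of `G(y₀) + d y₀²`.
      have e : 1 - (d : ℂ) * ((r : ℂ) ^ 2 / (Complex.I * ((r ^ 2 / y₀ : ℝ) : ℂ)) ^ 2)
          = (((r ^ 2 + d * y₀ ^ 2) / r ^ 2 : ℝ) : ℂ) := by
        rw [mul_pow, Complex.I_sq]
        push_cast
        field_simp
        ring
      rw [e]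
      exact_mod_cast (div_pos hdpos (by positivity)).ne')
  have hφne : ∀ z ∈ Metric.ball (0 : ℂ) δ, φ z ≠ 0 := fun z hz =>
    ne_zero_of_mem_upperHalf (hφmem z hz).1
  have hφ₂c : ContinuousOn (fun z => z - (r : ℂ) ^ 2 / φ z) (Metric.ball 0 δ) :=
    continuousOn_id.sub (continuousOn_const.div hφc hφne)
  set M : ℂ → ℂ := fun z => stieltjes (symmetrization μ) (z - (r : ℂ) ^ 2 / φ z) with hM
  have hMc : ContinuousOn M (Metric.ball 0 δ) :=
    differentiableOn_stieltjes.continuousOn.comp hφ₂c fun z hz => (hφmem z hz).2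
  have ht1 : Tendsto ω₁ (𝓝[upperHalf] 0) (𝓝 (φ 0)) :=
    tendsto_nhdsWithin_upperHalf_zero hδ hφc fun z hz hzu => by
      rw [hω₁z z hzu, hφeq z hz hzu]
  have ht2 : Tendsto ω₂ (𝓝[upperHalf] 0) (𝓝 (0 - (r : ℂ) ^ 2 / φ 0)) :=
    tendsto_nhdsWithin_upperHalf_zero hδ hφ₂c fun z hz hzu => by
      rw [hω₂z z hzu, hφeq z hz hzu]
  have hmM : ∀ z ∈ Metric.ball (0 : ℂ) δ, z ∈ upperHalf → m z = M z := fun z hz hzu => by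
    rw [hmz z hzu, hω₂z z hzu, hφeq z hz hzu]
  have ht3 : Tendsto m (𝓝[upperHalf] 0) (𝓝 (M 0)) :=
    tendsto_nhdsWithin_upperHalf_zero hδ hMc hmM
  have hval₂ : 0 - (r : ℂ) ^ 2 / φ 0 = Complex.I * y₀ := by rw [hφ0, zero_sub, hw₀]
  have hM0 : M 0 = stieltjes (symmetrization μ) (Complex.I * y₀) := by
    simp only [hM, hval₂]
  refine ⟨⟨⟨_, ht1⟩, ⟨_, ht2⟩, ⟨_, ht3⟩⟩, fun η hη => ?_, ?_⟩
  · rcases hη.eq_or_lt with rfl | hη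
    · refine ⟨y₀, r ^ 2 / y₀, by positivity, ?_, ?_, ?_, ?_, ?_⟩
      · field_simp
        ring
      · rw [hgy₀]
        field_simp
        ring
      · rw [Complex.ofReal_zero, mul_zero, extendToBoundary_of_tendsto (by simp) ht1, hφ0]
      · rw [Complex.ofReal_zero, mul_zero, extendToBoundary_of_tendsto (by simp) ht2, hval₂]
      · rw [Complex.ofReal_zero, mul_zero, extendToBoundary_of_tendsto (by simp) ht3, hM0]
        exact hval 0 y₀ (r ^ 2 / y₀) hy₀ (by rw [hg₀, sub_zero])
    · have hz := I_mul_mem_upperHalf hη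
      have hωI := subordinationFixedPoint_I_mul H
        (fun w hw => subordinationPart_symmetrization_neg_conj hw) r hη
      have hωm := H.subordinationFixedPoint_mem r hz
      have hfix := H.subordinationMap_fixedPoint r hz
      set y₁ := (subordinationFixedPoint g r (Complex.I * η)).im
      have hy₁ : 0 < y₁ := hωm
      have hy₁C : (y₁ : ℂ) ≠ 0 := by exact_mod_cast hy₁.ne'
      set y := η + r ^ 2 / y₁
      have hy : 0 < y := by positivity
      have hw : Complex.I * η - (r : ℂ) ^ 2 / subordinationFixedPoint g r (Complex.I * η)
          = Complex.I * y := by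
        rw [hωI]
        simp only [y]
        push_cast
        have := Complex.I_ne_zero
        field_simp
        linear_combination -(r : ℂ) ^ 2 * Complex.I_sq
      have hgy : g (Complex.I * y) = Complex.I * ((y₁ - η : ℝ) : ℂ) := by
        rw [subordinationMap, hw, hωI] at hfix
        push_cast
        linear_combination hfix
      refine ⟨y, y₁, hy₁, rfl, ?_, ?_, ?_, ?_⟩
      · rw [hgy]
        simp
      · rw [extendToBoundary_of_mem (by rw [hω₁]; exact hpair.analytic_fst.continuousOn) hz,
          hω₁z _ hz, hωI]
      · rw [extendToBoundary_of_mem (by rw [hω₂]; exact hpair.analytic_snd.continuousOn) hz,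
          hω₂z _ hz, hw]
      · rw [extendToBoundary_of_mem (by rw [hm]; exact differentiableOn_stieltjes.continuousOn) hz,
          hmz _ hz, hω₂z _ hz, hw, hval η y y₁ hy hgy]
  · rw [extendToBoundary_of_tendsto (by simp) ht3]
    exact hasDensityAt_of_continuousOn hδ hMc fun z hz hzu => by rw [← hm, hmM z hz hzu]

end Main

theorem mainTheorem7 (μσ : Measure ℝ) [IsProbabilityMeasure μσ]
    (hcompact : ∃ s : ℝ, μσ.support ⊆ Icc 0 s) :
    (μσ.support.Nontrivial ↔ innerRadius μσ < outerRadius μσ) ∧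
    (μσ.support.Nontrivial → ∀ τ : ℝ, 0 < τ → ∀ ηM : ℝ,
      ∃ c C : ℝ, 0 < c ∧
        ∀ r ∈ Icc (innerRadius μσ + τ) (outerRadius μσ - τ),
          let μ₁ := symmetrization μσ
          let μ₂ := symmetrization (Measure.dirac r)
          let ω₁ := (subordinationPair μ₁ μ₂).1
          let ω₂ := (subordinationPair μ₁ μ₂).2
          let m := stieltjes (freeAddConv μ₁ μ₂)
          IsSubordinationPair μ₁ μ₂ (ω₁, ω₂) ∧ IsFreeAddConv μ₁ μ₂ (freeAddConv μ₁ μ₂) ∧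
          HasBoundaryValue ω₁ 0 ∧ HasBoundaryValue ω₂ 0 ∧ HasBoundaryValue m 0 ∧
          (∀ η ∈ Icc (0 : ℝ) ηM,
            ‖extendToBoundary ω₁ (Complex.I * η)‖ ≤ C ∧
            ‖extendToBoundary ω₂ (Complex.I * η)‖ ≤ C ∧
            c ≤ (extendToBoundary ω₁ (Complex.I * η)).im ∧
            c ≤ (extendToBoundary ω₂ (Complex.I * η)).im ∧
            c ≤ ‖extendToBoundary m (Complex.I * η)‖ ∧
            ‖extendToBoundary m (Complex.I * η)‖ ≤ C) ∧
          ∃ d : ℝ, HasDensityAt (freeAddConv μ₁ μ₂) 0 d ∧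
            c ≤ Real.pi * d ∧ Real.pi * d ≤ C) := by
  obtain ⟨s, hs⟩ := hcompact
  have h := ae_mem_Icc_of_support_subset hs
  have hpos : ∀ᵐ x ∂μσ, (0 : ℝ) ≤ x := h.mono fun x hx => hx.1
  have habs : ∀ᵐ x ∂μσ, |x| ≤ s := h.mono fun x hx => by rw [abs_of_nonneg hx.1]; exact hx.2
  refine ⟨⟨innerRadius_lt_outerRadius h, support_nontrivial_of_innerRadius_lt h⟩,
    fun hn τ hτ ηM => ?_⟩
  set lo := innerRadius μσ + τ with hlo_def
  set hi := outerRadius μσ - τ with hhi_def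
  have hlo : 0 < lo := add_pos_of_nonneg_of_pos innerRadius_nonneg hτ
  -- If `J` is empty, any constants do.
  rcases lt_or_ge hi lo with hJ | hJ
  · exact ⟨1, 1, one_pos, fun r hr => absurd (hr.1.trans hr.2) (not_le.2 hJ)⟩
  have hhi : 0 < hi := hlo.trans_le hJ
  have H := isPickMap_subordinationPart_symmetrization habs
  set A := ∫ x, x ^ 2 ∂μσ
  have hA : 0 ≤ A := integral_nonneg fun x => sq_nonneg x
  -- The thresholds `a` and `b` are taken for the endpoints of `J`, so they serve every `r` in `J`.
  obtain ⟨a, ha, hGa⟩ := exists_forall_mul_im_subordinationPart_lt hpos hlo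
    (show innerRadius μσ < lo by linarith)
  obtain ⟨b, hb, hGb⟩ := exists_forall_lt_mul_im_subordinationPart h hhi.le
    (show hi < outerRadius μσ by linarith)
  -- `ηM` may be negative, whereas the density bound always needs `η = 0`.
  set N := max ηM 0
  have hN : 0 ≤ N := le_max_right _ _
  set Y := max b (N + hi)
  have hY : 0 < Y := lt_max_of_lt_left hb
  set y_lo := min a lo
  have hy_lo : 0 < y_lo := lt_min ha hlo
  set c₁ := lo ^ 2 / Y
  have hc₁ : 0 < c₁ := by positivity
  set Y₁ := N + A / y_lo
  have hY₁ : 0 ≤ Y₁ := by positivity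
  -- Here `y` lies in `[y_lo, Y]` and `y₁` in `[c₁, Y₁]`. Since `0 ≤ η < y`, the sum `y + y₁ - η`,
  -- whose inverse is `|m(iη)|`, lies in `[c₁, Y + Y₁]`.
  refine ⟨min y_lo (min c₁ (Y + Y₁)⁻¹), max Y (max Y₁ c₁⁻¹), ?_, fun r hr => ?_⟩
  · exact lt_min hy_lo (lt_min hc₁ (by positivity))
  intro μ₁ μ₂ ω₁ ω₂ m
  have hr0 : 0 < r := hlo.trans_le hr.1
  have hr_lo : lo ^ 2 ≤ r ^ 2 := pow_le_pow_left₀ hlo.le hr.1 2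
  have hr_hi : r ^ 2 ≤ hi ^ 2 := pow_le_pow_left₀ hr0.le hr.2 2
  have hpair := isSubordinationPair_subordinationPair H r
  obtain ⟨⟨hb1, hb2, hb3⟩, hax, hdens⟩ := freeAddConv_boundary_behaviour h hn hr0 ha hb
    ((hGa a ha le_rfl).trans_le hr_lo) (hr_hi.trans_lt (hGb b le_rfl))
    (ω₁ := ω₁) (ω₂ := ω₂) (m := m) rfl rfl rfl rfl
  have hbound : ∀ η : ℝ, 0 ≤ η → η ≤ N → ∃ y y₁ u : ℝ,
      extendToBoundary ω₁ (Complex.I * η) = Complex.I * y₁ ∧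
      extendToBoundary ω₂ (Complex.I * η) = Complex.I * y ∧
      extendToBoundary m (Complex.I * η) = Complex.I * u ∧
      0 < y ∧ 0 < y₁ ∧ 0 < u ∧ y_lo ≤ y ∧ y ≤ Y ∧ c₁ ≤ y₁ ∧ y₁ ≤ Y₁ ∧
      (Y + Y₁)⁻¹ ≤ u ∧ u ≤ c₁⁻¹ := by
    intro η hη hηN
    obtain ⟨y, y₁, hy₁, hy, hG, e1, e2, e3⟩ := hax η hη
    have hq : 0 < r ^ 2 / y₁ := by positivity
    have hy0 : 0 < y := by linarith
    have hGA : y * (subordinationPart (symmetrization μσ) (Complex.I * y)).im ≤ A := by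
      have h3 := H.norm_le _ (I_mul_mem_upperHalf hy0)
      have h4 := ((le_abs_self _).trans (Complex.abs_im_le_norm _)).trans h3
      have h5 : (Complex.I * (y : ℂ)).im = y := by simp
      rw [h5, le_div_iff₀ hy0] at h4
      linarith
    obtain ⟨k1, k2, k3, k4⟩ := subordination_bounds ha hlo hA hr.1 hr.2 hη hηN hy₁ hy hG hGA
      (fun hya => (hGa y hy0 hya).trans_le hr_lo) (fun hyb => hr_hi.trans_lt (hGb y hyb))
    have hu : 0 < y + y₁ - η := by linarith
    refine ⟨y, y₁, (y + y₁ - η)⁻¹, e1, e2, e3, hy0, hy₁, by positivity, k1, k2, k3, k4,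
      inv_anti₀ hu (by linarith), inv_anti₀ hc₁ (by linarith)⟩
  have hnorm : ∀ t : ℝ, 0 < t → ‖Complex.I * (t : ℂ)‖ = t := fun t ht => by simp [abs_of_pos ht]
  have him : ∀ t : ℝ, (Complex.I * (t : ℂ)).im = t := fun t => by simp
  refine ⟨hpair, isFreeAddConv_freeAddConv hpair, hb1, hb2, hb3, fun η hη => ?_, _, hdens, ?_⟩
  · obtain ⟨y, y₁, u, e1, e2, e3, p1, p2, p3, k1, k2, k3, k4, k5, k6⟩ :=
      hbound η hη.1 (hη.2.trans (le_max_left _ _))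
    rw [e1, e2, e3, hnorm _ p1, hnorm _ p2, hnorm _ p3, him, him]
    exact ⟨k4.trans ((le_max_left _ _).trans (le_max_right _ _)), k2.trans (le_max_left _ _),
      ((min_le_right _ _).trans (min_le_left _ _)).trans k3, (min_le_left _ _).trans k1,
      ((min_le_right _ _).trans (min_le_right _ _)).trans k5,
      k6.trans ((le_max_right _ _).trans (le_max_right _ _))⟩
  · obtain ⟨y, y₁, u, -, -, e3, -, -, -, -, -, -, -, k5, k6⟩ := hbound 0 le_rfl hN
    rw [Complex.ofReal_zero, mul_zero] at e3
    rw [e3, him, mul_div_cancel₀ _ Real.pi_ne_zero]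
    exact ⟨((min_le_right _ _).trans (min_le_right _ _)).trans k5,
      k6.trans ((le_max_right _ _).trans (le_max_right _ _))⟩
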